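/- **Capacity of the Gaussian many-access channel with known user activities.** All logarithms are natural and message lengths are in nats. Fix a power $P>0$. For each block length $n$ there are $\ell_n$ users, of which exactly $k_n\ge 1$ are active, with $k_n=O(n)$; the set $A$ of active users may have any law on the $k_n$-element subsets of the set of users (in particular it may be deterministic, e.g. all users with $\ell_n=k_n$), and it is revealed to the receiver. An $(M,n)$ code assigns to each user $i$ and each message $w\in\{0,1,\dots,M\}$ a codeword $s_i(w)\in\mathbb R^n$ with $\frac1n\sum_{t=1}^n s_{i,t}(w)^2\le P$ and $s_i(0)=0$, where $0$ is the message of an inactive user, together with a (measurable) decision rule that maps the revealed set $A$ and the received word $Y=\sum_i s_i(W_i)+Z$ to an estimate of all messages; $Z$ has independent standard Gaussian entries. Given $A$, the messages of the active users are independent and uniform on $\{1,\dots,M\}$, and $W_i=0$ for $i\notin A$. The average error probability is the probability that the estimate differs from $(W_i)_i$. A sequence of message lengths $v(n)$ is *asymptotically achievable* if there are $(\lceil e^{v(n)}\rceil,n)$ codes whose average error probability tends to $0$ as $n\to\infty$. A sequence $C(n)$ is a *symmetric capacity* if for every $0<\epsilon<1$ the sequence $(1-\epsilon)C(n)$ is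 asymptotically achievable and $(1+\epsilon)C(n)$ is not. Then $$C_1(n)=\frac{n}{2k_n}\log(1+k_nP)$$ is a symmetric capacity. Moreover, for every $\epsilon>0$ the sequence of message lengths $$v(n)=C_1(n)\Bigl(1-\frac{\epsilon}{\log(1+k_nP)}\Bigr)$$ is asymptotically achievable. It is also achieved by Gaussian random codebooks with maximum-likelihood decoding: for every $\epsilon>0$ there is $P'\in(0,P)$ such that, if the codewords of the messages $1,\dots,\lceil e^{v(n)}\rceil$ of all users are drawn with i.i.d. $\mathcal N(0,P')$ entries, then the probability, over codebooks, noise, active set and messages, that a maximum-likelihood decision differs from the message vector sent or that a transmitted codeword violates the power constraint $P$ tends to $0$ as $n\to\infty$. -/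

import Mathlib

open MeasureTheory ProbabilityTheory Filter Topology Asymptotics
open scoped NNReal

noncomputable section

namespace ManyAccess

/-- An `(M, n)` code for the Gaussian many-access channel with `l` users and power `P`, for a
receiver that is told which users are active. Message `0` is the message of an inactive user, the
messages `1, …, M` are those of an active user. -/
structure Code (l M n : ℕ) (P : ℝ) where
  /-- `enc i w` is the codeword of user `i` for message `w`. -/
  enc : Fin l → Fin (M + 1) → Fin n → ℝ
  /-- Every codeword satisfies the power constraint. -/
  power : ∀ i w, (1 / (n : ℝ)) * ∑ t, enc i w t ^ 2 ≤ P
  /-- An inactive user transmits the all-zero codeword. -/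
  enc_zero : ∀ i, enc i 0 = 0
  /-- `dec A y` is the decision on all messages when the set of active users is revealed to be `A`
  and the received word is `y`. -/
  dec : Finset (Fin l) → (Fin n → ℝ) → (Fin l → Fin (M + 1))
  /-- The decision rule is measurable in the received word. -/
  measurable_dec : ∀ A, Measurable (dec A)

/-- The message vectors that are possible when `A` is the set of active users: the users in `A`
have messages in `{1, …, M}`, all others have message `0`. There are `M ^ #A` of them. -/
def messages {l : ℕ} (M : ℕ) (A : Finset (Fin l)) : Finset (Fin l → Fin (M + 1)) :=
  Fintype.piFinset fun i => if i ∈ A then Finset.univ.erase 0 else {0}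

/-- The law of the noise: `n` independent standard Gaussian entries. -/
def noise (n : ℕ) : Measure (Fin n → ℝ) :=
  Measure.pi fun _ => gaussianReal 0 1

/-- The received word when the codebooks are `s`, the messages are `w` and the noise is `z`. -/
def received {l M n : ℕ} (s : Fin l → Fin (M + 1) → Fin n → ℝ) (w : Fin l → Fin (M + 1))
    (z : Fin n → ℝ) : Fin n → ℝ :=
  ∑ i, s i (w i) + z

/-- The error probability of a code when the set of active users is `A` and the message vector is
`w`. -/
def Code.errorGiven {l M n : ℕ} {P : ℝ} (c : Code l M n P) (A : Finset (Fin l))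
    (w : Fin l → Fin (M + 1)) : ℝ :=
  (noise n).real {z | c.dec A (received c.enc w z) ≠ w}

/-- The average error probability of a code: the set of active users has law `π` and, given that
set, the messages of the active users are independent and uniform on `{1, …, M}`. -/
def Code.avgError {l M n : ℕ} {P : ℝ} (c : Code l M n P) (π : PMF (Finset (Fin l))) : ℝ :=
  ∑ A, (π A).toReal * ((∑ w ∈ messages M A, c.errorGiven A w) / (M : ℝ) ^ A.card)

/-- The message length sequence `v` (in nats) is asymptotically achievable when, at block length
`n`, there are `l n` users and the set of active users has law `π n` and is revealed to the
receiver. -/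
def Achievable (l : ℕ → ℕ) (π : ∀ n, PMF (Finset (Fin (l n)))) (P : ℝ) (v : ℕ → ℝ) : Prop :=
  ∃ c : ∀ n, Code (l n) ⌈Real.exp (v n)⌉₊ n P,
    Tendsto (fun n => (c n).avgError (π n)) atTop (𝓝 0)

/-- `C` is a symmetric capacity of the Gaussian many-access channel with known user activities. -/
def IsSymmetricCapacity (l : ℕ → ℕ) (π : ∀ n, PMF (Finset (Fin (l n)))) (P : ℝ) (C : ℕ → ℝ) :
    Prop :=
  ∀ ε : ℝ, 0 < ε → ε < 1 →
    Achievable l π P (fun n => (1 - ε) * C n) ∧ ¬ Achievable l π P (fun n => (1 + ε) * C n)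

/-- The function `C₁(n) = n / (2 k) * log (1 + k P)` of the block length `n` and the number `k` of
active users. -/
def C₁ (P : ℝ) (k n : ℕ) : ℝ :=
  (n : ℝ) / (2 * (k : ℝ)) * Real.log (1 + (k : ℝ) * P)

/-- The law of Gaussian random codebooks: all entries of all codewords are independent, those of
the messages `1, …, M` have law `N(0, Q)`, and message `0` has the all-zero codeword (a Gaussian
of variance `0` is the constant `0`). -/
def gaussianCodebooks (l M n : ℕ) (Q : ℝ≥0) : Measure (Fin l → Fin (M + 1) → Fin n → ℝ) :=
  Measure.pi fun _ => Measure.pi fun m => Measure.pi fun _ =>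
    gaussianReal 0 (if m = 0 then 0 else Q)

/-- `w` is a maximum likelihood decision for the received word `y`, given the codebooks `s` and
the set `A` of active users (the noise is white Gaussian, so this is a nearest point rule). -/
def IsMLDecision {l M n : ℕ} (s : Fin l → Fin (M + 1) → Fin n → ℝ) (A : Finset (Fin l))
    (y : Fin n → ℝ) (w : Fin l → Fin (M + 1)) : Prop :=
  w ∈ messages M A ∧ ∀ w' ∈ messages M A,
    ∑ t, (y t - ∑ i, s i (w i) t) ^ 2 ≤ ∑ t, (y t - ∑ i, s i (w' i) t) ^ 2

/-- Transmission of `w` with the codebooks `s` and noise `z` fails: a maximum likelihood decision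
differs from `w`, or one of the transmitted codewords violates the power constraint. -/
def MLFailure {l M n : ℕ} (P : ℝ) (s : Fin l → Fin (M + 1) → Fin n → ℝ) (A : Finset (Fin l))
    (w : Fin l → Fin (M + 1)) (z : Fin n → ℝ) : Prop :=
  (∃ w', IsMLDecision s A (received s w z) w' ∧ w' ≠ w) ∨
    ∃ i, P < (1 / (n : ℝ)) * ∑ t, s i (w i) t ^ 2

/-- The probability of failure of maximum likelihood decoding under the power constraint `P`,
averaged over Gaussian random codebooks with `N(0, Q)` entries, the noise, the set of active users
and the messages. -/
def gaussianMLError (l M n : ℕ) (P : ℝ) (Q : ℝ≥0) (π : PMF (Finset (Fin l))) : ℝ :=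
  ∑ A, (π A).toReal * ((∑ w ∈ messages M A,
    ((gaussianCodebooks l M n Q).prod (noise n)).real {x | MLFailure P x.1 A w x.2}) /
      (M : ℝ) ^ A.card)

end ManyAccess

end

/-! Direct part. Codebooks are Gaussian with variance `Q` slightly below `P`. A wrong
maximum-likelihood decision is classified by the set `S` of users whose messages differ. For `#S =
j` the users in `S` act like one user with Gaussian input of variance `jQ` and at most `(M - 1) ^ j`
competitors, so Gallager's bound (`gallager_bound`) gives `(M - 1) ^ (jρ) * (1 + jq) ^ (-ρn/2)` with
`q = Q / (1 + ρ)`. Both `Q` and `ρ` are fixed once `ε` is, and replacing `P` by `q` costs at most `ε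
/ 2` in the logarithm. What remains is `∑ j, choose k j * exp (-(ρn/2) * (logExcess q k j + (j/k) *
ε/2))`. The difficulty is that `k` may grow linearly in `n`, so that `2 ^ k` sets compete with an
exponent of order `n`. Concavity of `log` rescues the sum (`logExcess_ge`,
`exists_exponentSum_bound`): the excess over the chord makes the terms with small `j` negligible and
dominates the others by those of a binomial expansion `(a + b) ^ k` with `a + b < 1`. Chernoff's
bound controls the power violations. Averaging over codebooks then yields one good codebook, and
clipping its overpowered codewords yields a code (`exists_code_avgError_le`). Converse. A change of
measure takes the place of entropy. The output law for each message vector is compared with one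
Gaussian law of variance `1 + kP` per entry, centred at the mean output. The pointwise inequality
behind `mul_noise_le`, summed over the disjoint decision regions, bounds `k log M` times the
probability of a correct decision by `n/2 * log (1 + kP) + 1` (`Code.sum_correct_le`). Independence
of the messages enters only through the variance of the superposed codewords (`Code.exists_center`).
-/

namespace ManyAccess

/-! ### Gaussian integrals and Chernoff's bound -/

/-- The Gaussian integral of the exponential of a quadratic function. -/
lemma lintegral_exp_quadratic_gaussianReal (v : ℝ≥0) (a b : ℝ) (h : 0 < 1 + a * v) :
    ∫⁻ x, ENNReal.ofReal (Real.exp (-(a / 2) * x ^ 2 + b * x)) ∂gaussianReal 0 v =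
      ENNReal.ofReal ((√(1 + a * v))⁻¹ * Real.exp (b ^ 2 * v / (2 * (1 + a * v)))) := by
  rcases eq_or_ne v 0 with rfl | hv
  · simp [gaussianReal_zero_var]
  have hv0 : (0 : ℝ) < v := lt_of_le_of_ne v.2 (by exact_mod_cast hv.symm)
  have hc : 1 + (v : ℝ) * a ≠ 0 := by rw [mul_comm]; exact h.ne'
  -- Completing the square: density times integrand is a constant times the density of mean `b * v'`
  -- and variance `v'`.
  set v' : ℝ≥0 := ⟨v / (1 + a * v), by positivity⟩ with hv'
  have hv'0 : v' ≠ 0 := by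
    intro h0
    have : (v' : ℝ) = 0 := by rw [h0]; rfl
    have h2 : (v' : ℝ) = v / (1 + a * v) := rfl
    rw [h2] at this
    have : (0 : ℝ) < v / (1 + a * v) := by positivity
    linarith
  set K := (√(1 + a * v))⁻¹ * Real.exp (b ^ 2 * v / (2 * (1 + a * v))) with hK
  have key : ∀ x : ℝ, gaussianPDFReal 0 v x * Real.exp (-(a / 2) * x ^ 2 + b * x) =
      K * gaussianPDFReal (b * v') v' x := by
    intro x
    have h2 : (v' : ℝ) = v / (1 + a * v) := rfl
    have hs : (√(2 * Real.pi * v))⁻¹ = (√(1 + a * v))⁻¹ * (√(2 * Real.pi * v'))⁻¹ := by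
      rw [← mul_inv, ← Real.sqrt_mul h.le, h2]
      congr 2
      field_simp
    rw [gaussianPDFReal, gaussianPDFReal, hs, hK]
    have : Real.exp (-(x - 0) ^ 2 / (2 * v)) * Real.exp (-(a / 2) * x ^ 2 + b * x) =
        Real.exp (b ^ 2 * v / (2 * (1 + a * v))) * Real.exp (-(x - b * v') ^ 2 / (2 * v')) := by
      rw [← Real.exp_add, ← Real.exp_add, h2]
      congr 1
      field_simp
      ring
    linear_combination (√(1 + a * v))⁻¹ * (√(2 * Real.pi * v'))⁻¹ * this
  rw [gaussianReal_of_var_ne_zero _ hv, lintegral_withDensity_eq_lintegral_mul _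
    (measurable_gaussianPDF _ _) (by fun_prop)]
  have : ∀ x, (gaussianPDF 0 v * fun x => ENNReal.ofReal (Real.exp (-(a / 2) * x ^ 2 + b * x))) x =
      ENNReal.ofReal K * gaussianPDF (b * v') v' x := by
    intro x
    rw [Pi.mul_apply, gaussianPDF, gaussianPDF, ← ENNReal.ofReal_mul (gaussianPDFReal_nonneg _ _ _),
      key, ENNReal.ofReal_mul (by positivity)]
  simp_rw [this]
  rw [lintegral_const_mul _ (measurable_gaussianPDF _ _), lintegral_gaussianPDF_eq_one _ hv'0,
    mul_one]

/-- Tonelli's theorem for a product of functions of the separate coordinates. -/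
lemma lintegral_pi_prod {ι : Type*} [Fintype ι] {α : ι → Type*} [∀ i, MeasurableSpace (α i)]
    (μ : ∀ i, Measure (α i)) [∀ i, IsProbabilityMeasure (μ i)] (f : ∀ i, α i → ENNReal)
    (hf : ∀ i, Measurable (f i)) :
    ∫⁻ x, ∏ i, f i (x i) ∂Measure.pi μ = ∏ i, ∫⁻ x, f i x ∂μ i := by
  have hind : iIndepFun (fun i (x : ∀ i, α i) => f i (x i)) (Measure.pi μ) :=
    iIndepFun_pi fun i => (hf i).aemeasurable
  rw [lintegral_prod_eq_prod_lintegral_of_indepFun Finset.univ _ hind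
    fun i => (hf i).comp (measurable_pi_apply i)]
  refine Finset.prod_congr rfl fun i _ => ?_
  rw [← (measurePreserving_eval μ i).lintegral_comp (hf i)]

/-- The law of a vector of `n` independent centred Gaussian entries of variance `v`. -/
noncomputable abbrev iidGaussian (n : ℕ) (v : ℝ≥0) : Measure (Fin n → ℝ) :=
  Measure.pi fun _ => gaussianReal 0 v

lemma lintegral_exp_quadratic_iidGaussian {n : ℕ} (v : ℝ≥0) (a : ℝ) (b : Fin n → ℝ)
    (h : 0 < 1 + a * v) :
    ∫⁻ x, ENNReal.ofReal (Real.exp (-(a / 2) * ∑ t, x t ^ 2 + ∑ t, b t * x t)) ∂iidGaussian n v =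
      ENNReal.ofReal ((√(1 + a * v))⁻¹ ^ n *
        Real.exp ((∑ t, b t ^ 2) * v / (2 * (1 + a * v)))) := by
  have h1 : ∀ x : Fin n → ℝ,
      ENNReal.ofReal (Real.exp (-(a / 2) * ∑ t, x t ^ 2 + ∑ t, b t * x t)) =
      ∏ t, ENNReal.ofReal (Real.exp (-(a / 2) * x t ^ 2 + b t * x t)) := by
    intro x
    rw [← ENNReal.ofReal_prod_of_nonneg fun _ _ => (Real.exp_pos _).le, ← Real.exp_sum,
      Finset.mul_sum, Finset.sum_add_distrib]
  simp_rw [h1]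
  rw [lintegral_pi_prod _ (fun t (y : ℝ) =>
    ENNReal.ofReal (Real.exp (-(a / 2) * y ^ 2 + b t * y))) (by fun_prop)]
  simp_rw [lintegral_exp_quadratic_gaussianReal v a _ h]
  rw [← ENNReal.ofReal_prod_of_nonneg fun _ _ => by positivity, Finset.prod_mul_distrib,
    ← Real.exp_sum, Finset.prod_const, Finset.card_univ, Fintype.card_fin, Finset.sum_mul,
    Finset.sum_div]

/-- Smoothing a Gaussian kernel of precision `a` by variance `v` changes its precision to `a / (1 +
a * v)`. Negative `a` is allowed, which Chernoff's bound needs. -/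
lemma lintegral_exp_sub_sq_iidGaussian {n : ℕ} (v : ℝ≥0) (a : ℝ) (y : Fin n → ℝ)
    (h : 0 < 1 + a * v) :
    ∫⁻ x, ENNReal.ofReal (Real.exp (-(a / 2) * ∑ t, (y t - x t) ^ 2)) ∂iidGaussian n v =
      ENNReal.ofReal ((√(1 + a * v))⁻¹ ^ n *
        Real.exp (-(a / (1 + a * v) / 2) * ∑ t, y t ^ 2)) := by
  have h1 : ∀ x : Fin n → ℝ,
      ENNReal.ofReal (Real.exp (-(a / 2) * ∑ t, (y t - x t) ^ 2)) =
      ENNReal.ofReal (Real.exp (-(a / 2) * ∑ t, y t ^ 2)) *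
      ENNReal.ofReal (Real.exp (-(a / 2) * ∑ t, x t ^ 2 + ∑ t, (a * y t) * x t)) := by
    intro x
    rw [← ENNReal.ofReal_mul (Real.exp_pos _).le, ← Real.exp_add]
    congr 2
    simp only [Finset.mul_sum, ← Finset.sum_add_distrib]
    exact Finset.sum_congr rfl fun t _ => by ring
  simp_rw [h1]
  rw [lintegral_const_mul _ (by fun_prop), lintegral_exp_quadratic_iidGaussian v a _ h,
    ← ENNReal.ofReal_mul (Real.exp_pos _).le, mul_left_comm, ← Real.exp_add]
  have hc : 1 + a * (v : ℝ) ≠ 0 := h.ne'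
  congr 4
  simp only [mul_pow, ← Finset.mul_sum]
  field_simp
  ring

/-- Chernoff's bound for the norm of a Gaussian vector. -/
lemma iidGaussian_norm_gt_le {n : ℕ} {P : ℝ} {Q : ℝ≥0} (hQ : 0 < Q) (hQP : (Q : ℝ) < P)
    (hn : 0 < n) :
    iidGaussian n Q {x | P < (1 / (n : ℝ)) * ∑ t, x t ^ 2} ≤
      ENNReal.ofReal (√(P / Q * Real.exp (1 - P / Q)) ^ n) := by
  have hQ0 : (0 : ℝ) < Q := hQ
  have hP : 0 < P := hQ0.trans hQP
  have hn0 : (0 : ℝ) < n := by exact_mod_cast hn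
  -- The optimal Chernoff parameter: the tilt by `θ / 2` changes the variance from `Q` to `P`.
  set θ : ℝ := 1 / Q - 1 / P with hθ
  have hθ0 : 0 < θ := sub_pos.2 (one_div_lt_one_div_of_lt hQ0 hQP)
  have h1 : 1 + -θ * Q = Q / P := by rw [hθ]; field_simp; ring
  calc iidGaussian n Q {x | P < (1 / (n : ℝ)) * ∑ t, x t ^ 2}
      ≤ ∫⁻ x, ENNReal.ofReal (Real.exp (-(θ / 2) * (n * P))) *
          ENNReal.ofReal (Real.exp (-(-θ / 2) * ∑ t, (0 - x t) ^ 2)) ∂iidGaussian n Q := by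
        refine (measure_mono ?_).trans
          ((one_mul _).symm.trans_le
            (mul_meas_ge_le_lintegral₀ (Measurable.aemeasurable (by fun_prop)) 1))
        intro x hx
        rw [Set.mem_ofPred_eq] at hx
        rw [Set.mem_ofPred_eq, ← ENNReal.ofReal_mul (Real.exp_pos _).le, ← Real.exp_add,
          ENNReal.one_le_ofReal, Real.one_le_exp_iff]
        have h2 : n * P < ∑ t, x t ^ 2 := by
          have := mul_lt_mul_of_pos_left hx hn0
          rwa [← mul_assoc, mul_one_div_cancel hn0.ne', one_mul] at this
        simp only [zero_sub, neg_sq]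
        nlinarith
    _ = ENNReal.ofReal (√(P / Q * Real.exp (1 - P / Q)) ^ n) := by
        rw [lintegral_const_mul _ (by fun_prop),
          lintegral_exp_sub_sq_iidGaussian Q (-θ) (fun _ => 0) (by rw [h1]; positivity),
          ← ENNReal.ofReal_mul (Real.exp_pos _).le, h1]
        congr 1
        have h3 : Real.exp (-(θ / 2) * (n * P)) = √(Real.exp (1 - P / Q)) ^ n := by
          rw [← Real.exp_half, ← Real.exp_nat_mul, hθ]
          congr 1
          field_simp
          ring
        rw [h3, Real.sqrt_mul (by positivity), mul_pow, ← Real.sqrt_inv, inv_div]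
        simp [mul_comm]

/-! ### Joint law of superposed codewords, by characteristic functionals -/

lemma charFunDual_gaussianReal (v : ℝ≥0) (L : StrongDual ℝ ℝ) :
    charFunDual (gaussianReal 0 v) L = Complex.exp (-((v * L 1 ^ 2 : ℝ) : ℂ) / 2) := by
  have h : charFunDual (gaussianReal 0 v) L = charFun (gaussianReal 0 v) (L 1) := by
    rw [charFunDual_apply, charFun_apply_real]
    refine integral_congr_ae (Eventually.of_forall fun x => ?_)
    have : L x = L 1 * x := by
      conv_lhs => rw [← mul_one x, ← smul_eq_mul, map_smul, smul_eq_mul, mul_comm]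
    simp [this]
  rw [h, charFun_gaussianReal]
  congr 1
  push_cast
  ring

lemma charFunDual_iidGaussian {ι : Type*} [Fintype ι] [DecidableEq ι] (v : ι → ℝ≥0)
    (L : StrongDual ℝ (ι → ℝ)) :
    charFunDual (Measure.pi fun i => gaussianReal 0 (v i)) L =
      Complex.exp (-((∑ i, v i * L (Pi.single i 1) ^ 2 : ℝ) : ℂ) / 2) := by
  rw [charFunDual_pi]
  simp_rw [charFunDual_gaussianReal]
  rw [← Complex.exp_sum]
  congr 1
  push_cast
  rw [← Finset.sum_neg_distrib, Finset.sum_div]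
  rfl

/-- The exponent is a diagonal quadratic form in the coefficients of `L`, so the law of any linear
image of the codebooks can be read off by composing with that map. -/
lemma charFunDual_gaussianCodebooks {l M n : ℕ} (Q : ℝ≥0)
    (L : StrongDual ℝ (Fin l → Fin (M + 1) → Fin n → ℝ)) :
    charFunDual (gaussianCodebooks l M n Q) L =
      Complex.exp (-((∑ i, ∑ m, ∑ t, ((if m = 0 then 0 else Q : ℝ≥0) : ℝ) *
        L (Pi.single i (Pi.single m (Pi.single t 1))) ^ 2 : ℝ) : ℂ) / 2) := by
  rw [gaussianCodebooks, charFunDual_pi]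
  simp_rw [charFunDual_pi, charFunDual_gaussianReal]
  simp_rw [← Complex.exp_sum]
  congr 1
  push_cast
  simp_rw [← Finset.sum_neg_distrib, Finset.sum_div]
  rfl

instance (l M n : ℕ) (Q : ℝ≥0) : IsProbabilityMeasure (gaussianCodebooks l M n Q) := by
  unfold gaussianCodebooks; infer_instance

instance (n : ℕ) : IsProbabilityMeasure (noise n) := by
  unfold noise; infer_instance

/-- The continuous linear map that sends the codebooks to the superposition of the codewords of
the users in `S` for the messages `w`. -/
noncomputable def superposition {l M n : ℕ} (S : Finset (Fin l)) (w : Fin l → Fin (M + 1)) :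
    (Fin l → Fin (M + 1) → Fin n → ℝ) →L[ℝ] (Fin n → ℝ) :=
  ∑ i ∈ S, (ContinuousLinearMap.proj (R := ℝ) (φ := fun _ : Fin (M + 1) => Fin n → ℝ) (w i)).comp
    (ContinuousLinearMap.proj (R := ℝ) (φ := fun _ : Fin l => Fin (M + 1) → Fin n → ℝ) i)

lemma superposition_apply {l M n : ℕ} (S : Finset (Fin l)) (w : Fin l → Fin (M + 1))
    (s : Fin l → Fin (M + 1) → Fin n → ℝ) : superposition S w s = ∑ i ∈ S, s i (w i) := by
  simp [superposition]

/-- If no user in `S` has the same message in `w` and `w'`, the superpositions of their Gaussian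
codewords for `w` and for `w'` are independent Gaussian vectors. -/
lemma map_superposition_prod {l M n : ℕ} (Q : ℝ≥0) (S : Finset (Fin l))
    (w w' : Fin l → Fin (M + 1)) (hw : ∀ i ∈ S, w i ≠ 0) (hw' : ∀ i ∈ S, w' i ≠ 0)
    (hne : ∀ i ∈ S, w i ≠ w' i) :
    (gaussianCodebooks l M n Q).map ((superposition S w).prod (superposition S w')) =
      (iidGaussian n (S.card * Q)).prod (iidGaussian n (S.card * Q)) := by
  have : IsProbabilityMeasure ((gaussianCodebooks l M n Q).map
      ((superposition S w).prod (superposition S w'))) :=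
    Measure.isProbabilityMeasure_map (ContinuousLinearMap.measurable _).aemeasurable
  refine Measure.ext_of_charFunDual ?_
  ext L
  rw [charFunDual_map, charFunDual_gaussianCodebooks, charFunDual_prod, charFunDual_iidGaussian,
    charFunDual_iidGaussian, ← Complex.exp_add]
  congr 1
  rw [← add_div, ← neg_add, ← Complex.ofReal_add]
  congr 3
  set a : Fin n → ℝ := fun t => L (Pi.single t 1, 0) with ha
  set b : Fin n → ℝ := fun t => L (0, Pi.single t 1) with hb
  have hL : ∀ (i : Fin l) (m : Fin (M + 1)) (t : Fin n),
      (L.comp ((superposition S w).prod (superposition S w')))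
        (Pi.single i (Pi.single m (Pi.single t 1))) =
      if i ∈ S then (if w i = m then a t else 0) + (if w' i = m then b t else 0) else 0 := by
    intro i m t
    have h1 : ∀ u : Fin l → Fin (M + 1),
        superposition S u (Pi.single i (Pi.single m (Pi.single t (1 : ℝ)))) =
        if i ∈ S then (if u i = m then Pi.single t 1 else 0) else 0 := by
      intro u
      rw [superposition_apply]
      split_ifs with hi h2
      · rw [Finset.sum_eq_single i]
        · simp [h2]
        · intro j _ hj; simp [Pi.single_eq_of_ne hj]
        · exact fun h => absurd hi h
      · refine Finset.sum_eq_zero fun j _ => ?_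
        rcases eq_or_ne j i with rfl | hj
        · simp [h2]
        · simp [Pi.single_eq_of_ne hj]
      · refine Finset.sum_eq_zero fun j hj => ?_
        have : j ≠ i := fun h => hi (h ▸ hj)
        simp [Pi.single_eq_of_ne this]
    rw [ContinuousLinearMap.comp_apply, ContinuousLinearMap.prod_apply, h1, h1]
    have h2 : ∀ x y : Fin n → ℝ, L (x, y) = L (x, 0) + L (0, y) := by
      intro x y; rw [← map_add]; simp
    rw [h2]
    split_ifs <;> simp [ha, hb, ← Prod.zero_eq_mk]
  simp_rw [hL]
  have h3 : ∀ i : Fin l, (∑ m : Fin (M + 1), ∑ t, ((if m = 0 then 0 else Q : ℝ≥0) : ℝ) *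
      (if i ∈ S then (if w i = m then a t else 0) + (if w' i = m then b t else 0) else 0) ^ 2) =
      if i ∈ S then ∑ t, Q * (a t ^ 2 + b t ^ 2) else 0 := by
    intro i
    by_cases hi : i ∈ S
    · simp only [hi, if_true]
      rw [Finset.sum_comm]
      refine Finset.sum_congr rfl fun t _ => ?_
      -- A cross term `a t * b t` would need `w i = m = w' i`; its absence is the independence. As
      -- neither message is `0`, the vanishing variance plays no role.
      have h4 : ∀ m : Fin (M + 1), ((if m = 0 then 0 else Q : ℝ≥0) : ℝ) *
          ((if w i = m then a t else 0) + (if w' i = m then b t else 0)) ^ 2 =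
          (if w i = m then Q * a t ^ 2 else 0) + (if w' i = m then Q * b t ^ 2 else 0) := by
        intro m
        have := hw i hi
        have := hw' i hi
        have := hne i hi
        split_ifs <;> simp_all
      simp_rw [h4]
      rw [Finset.sum_add_distrib]
      simp [mul_add]
    · simp [hi]
  rw [Finset.sum_congr rfl fun i _ => h3 i, Finset.sum_ite_mem, Finset.univ_inter,
    Finset.sum_const, nsmul_eq_mul, ← Finset.sum_add_distrib, Finset.mul_sum]
  refine Finset.sum_congr rfl fun t _ => ?_
  simp only [ContinuousLinearMap.comp_apply, ContinuousLinearMap.inl_apply,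
    ContinuousLinearMap.inr_apply, ha, hb]
  push_cast
  ring

/-- Reduces an average over all codebooks to one over two independent Gaussian vectors, the
transmitted superposition and a single competitor. -/
lemma lintegral_superposition {l M n : ℕ} (Q : ℝ≥0) (S : Finset (Fin l))
    (w w' : Fin l → Fin (M + 1)) (hw : ∀ i ∈ S, w i ≠ 0) (hw' : ∀ i ∈ S, w' i ≠ 0)
    (hne : ∀ i ∈ S, w i ≠ w' i) (F : (Fin n → ℝ) → (Fin n → ℝ) → ENNReal)
    (hF : Measurable (Function.uncurry F)) :
    ∫⁻ s, F (superposition S w s) (superposition S w' s) ∂gaussianCodebooks l M n Q =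
      ∫⁻ x, ∫⁻ x', F x x' ∂iidGaussian n (S.card * Q) ∂iidGaussian n (S.card * Q) := by
  have h := lintegral_prod (μ := iidGaussian n (S.card * Q)) (ν := iidGaussian n (S.card * Q))
    (Function.uncurry F) hF.aemeasurable
  rw [← map_superposition_prod Q S w w' hw hw' hne,
    lintegral_map hF (ContinuousLinearMap.measurable _)] at h
  exact h

/-! ### Gallager's random coding bound -/

/-- Evaluation of Gallager's function for Gaussian inputs of variance `V`. -/
lemma lintegral_gallager {n : ℕ} (V : ℝ≥0) {ρ : ℝ} (hρ : 0 < ρ) :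
    ∫⁻ z, ∫⁻ x, ENNReal.ofReal (Real.exp (ρ * (1 / (1 + ρ)) / 2 * ∑ t, z t ^ 2) *
      ((√(1 + 1 / (1 + ρ) * V))⁻¹ ^ n * Real.exp (-(1 / (1 + ρ) / (1 + 1 / (1 + ρ) * V) / 2) *
        ∑ t, (z t + x t) ^ 2)) ^ ρ) ∂iidGaussian n V ∂noise n =
      ENNReal.ofReal (((√(1 + 1 / (1 + ρ) * V))⁻¹ ^ n) ^ ρ) := by
  have hV : (0 : ℝ) ≤ V := V.2
  set s : ℝ := 1 / (1 + ρ) with hs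
  have hs0 : 0 < s := by positivity
  set c : ℝ := 1 + s * V with hc
  have hc0 : 0 < c := by positivity
  set K : ℝ := (√c)⁻¹ ^ n with hK
  have hK0 : 0 < K := by positivity
  set a : ℝ := ρ * s / c with ha
  have ha0 : 0 < a := by positivity
  have h1a : 0 < 1 + a * V := by positivity
  have h1 : ∀ z x : Fin n → ℝ, ENNReal.ofReal (Real.exp (ρ * s / 2 * ∑ t, z t ^ 2) *
      (K * Real.exp (-(s / c / 2) * ∑ t, (z t + x t) ^ 2)) ^ ρ) =
      ENNReal.ofReal (Real.exp (ρ * s / 2 * ∑ t, z t ^ 2) * K ^ ρ) *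
        ENNReal.ofReal (Real.exp (-(a / 2) * ∑ t, (-z t - x t) ^ 2)) := by
    intro z x
    rw [← ENNReal.ofReal_mul (by positivity), Real.mul_rpow hK0.le (Real.exp_pos _).le,
      ← Real.exp_mul, mul_assoc (Real.exp _) (K ^ ρ)]
    have : ∀ t, (z t + x t) ^ 2 = (-z t - x t) ^ 2 := fun t => by ring
    simp_rw [this]
    congr 4
    rw [ha]
    ring
  simp_rw [h1]
  have h2 : ∀ z : Fin n → ℝ, ∫⁻ x, ENNReal.ofReal (Real.exp (ρ * s / 2 * ∑ t, z t ^ 2) * K ^ ρ) *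
        ENNReal.ofReal (Real.exp (-(a / 2) * ∑ t, (-z t - x t) ^ 2)) ∂iidGaussian n V =
      ENNReal.ofReal (K ^ ρ * (√(1 + a * V))⁻¹ ^ n) *
        ENNReal.ofReal (Real.exp (-((a / (1 + a * V) - ρ * s) / 2) * ∑ t, (0 - z t) ^ 2)) := by
    intro z
    rw [lintegral_const_mul _ (by fun_prop), lintegral_exp_sub_sq_iidGaussian V a _ h1a,
      ← ENNReal.ofReal_mul (by positivity), ← ENNReal.ofReal_mul (by positivity)]
    congr 1
    rw [show K ^ ρ * (√(1 + a * V))⁻¹ ^ n *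
        Real.exp (-((a / (1 + a * V) - ρ * s) / 2) * ∑ t, (0 - z t) ^ 2) =
        K ^ ρ * (√(1 + a * V))⁻¹ ^ n * (Real.exp (ρ * s / 2 * ∑ t, z t ^ 2) *
          Real.exp (-(a / (1 + a * V) / 2) * ∑ t, (-z t) ^ 2)) by
      rw [← Real.exp_add]
      simp only [neg_sq, zero_sub]
      congr 2
      ring]
    ring
  simp_rw [h2]
  -- The normalising factors of the integrals over `x` and `z` cancel, because `1 - ρ * s = s` for
  -- the tilt `s = 1 / (1 + ρ)`; only `K ^ ρ` survives.
  have h3 : (1 + a * V) * (1 + (a / (1 + a * V) - ρ * s) * (1 : ℝ≥0)) = 1 := by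
    have e1 : (1 + a * V) * (1 + (a / (1 + a * V) - ρ * s) * (1 : ℝ≥0)) =
        (1 + a * V) * (1 - ρ * s) + a := by
      rw [NNReal.coe_one]; field_simp; ring
    have e2 : 1 - ρ * s = s := by rw [hs]; field_simp; ring
    rw [e1, e2, ha]
    have e3 : s * (1 + ρ) = 1 := by rw [hs]; field_simp
    field_simp
    have e4 : c + ρ * s * V + ρ = c * (1 + ρ) := by rw [hc]; ring
    have e5 : s * (c + ρ * s * V + ρ) = c := by rw [e4, mul_left_comm, e3, mul_one]
    linear_combination e5
  have h4 : 0 < 1 + (a / (1 + a * V) - ρ * s) * (1 : ℝ≥0) := by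
    by_contra h
    nlinarith [mul_nonneg h1a.le (neg_nonneg.2 (not_lt.1 h))]
  rw [lintegral_const_mul _ (by fun_prop), noise, lintegral_exp_sub_sq_iidGaussian 1 _ _ h4,
    ← ENNReal.ofReal_mul (by positivity)]
  congr 1
  rw [mul_assoc, ← mul_assoc ((√(1 + a * V))⁻¹ ^ n), ← mul_pow, ← mul_inv,
    ← Real.sqrt_mul h1a.le, h3]
  simp

/-- The tangent line bound for the concave function `t ↦ t ^ ρ`. -/
lemma rpow_le_tangent {ρ t τ : ℝ} (hρ : 0 < ρ) (hρ1 : ρ ≤ 1) (ht : 0 ≤ t) (hτ : 0 < τ) :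
    t ^ ρ ≤ ρ * τ ^ (ρ - 1) * t + (1 - ρ) * τ ^ ρ := by
  have h := Real.geom_mean_le_arith_mean2_weighted hρ.le (sub_nonneg.2 hρ1) ht hτ.le (by ring)
  have h1 : 0 < τ ^ (ρ - 1) := Real.rpow_pos_of_pos hτ _
  have h2 : τ ^ (1 - ρ) * τ ^ (ρ - 1) = 1 := by rw [← Real.rpow_add hτ]; simp
  have h3 : τ ^ ρ = τ ^ (ρ - 1) * τ := by
    rw [← Real.rpow_add_one hτ.ne']; simp
  calc t ^ ρ = t ^ ρ * τ ^ (1 - ρ) * τ ^ (ρ - 1) := by rw [mul_assoc, h2, mul_one]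
    _ ≤ (ρ * t + (1 - ρ) * τ) * τ ^ (ρ - 1) := mul_le_mul_of_nonneg_right h h1.le
    _ = _ := by rw [h3]; ring

/-- Gallager's bound for the probability that one of the message vectors in `T`, all of which
differ from the transmitted one for every user in `S`, is at least as likely as that one. -/
lemma gallager_bound {l M n : ℕ} (Q : ℝ≥0) (S : Finset (Fin l)) (w : Fin l → Fin (M + 1))
    (T : Finset (Fin l → Fin (M + 1))) (hw : ∀ i ∈ S, w i ≠ 0)
    (hT : ∀ w' ∈ T, ∀ i ∈ S, w' i ≠ 0) (hne : ∀ w' ∈ T, ∀ i ∈ S, w i ≠ w' i)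
    {ρ : ℝ} (hρ : 0 < ρ) (hρ1 : ρ ≤ 1) :
    ((gaussianCodebooks l M n Q).prod (noise n)) {x | ∃ w' ∈ T,
      ∑ t, (x.2 t + superposition S w x.1 t - superposition S w' x.1 t) ^ 2 ≤ ∑ t, x.2 t ^ 2} ≤
      ENNReal.ofReal ((T.card : ℝ) ^ ρ *
        ((√(1 + 1 / (1 + ρ) * (S.card * Q : ℝ≥0)))⁻¹ ^ n) ^ ρ) := by
  rcases T.eq_empty_or_nonempty with rfl | hTne
  · simp
  have hN : (0 : ℝ) < T.card := by exact_mod_cast hTne.card_pos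
  set N : ℝ := (T.card : ℝ) with hNdef
  set V : ℝ≥0 := S.card * Q with hVdef
  have hV : (0 : ℝ) ≤ V := V.2
  set s : ℝ := 1 / (1 + ρ) with hs
  have hs0 : 0 < s := by positivity
  set c : ℝ := 1 + s * V with hc
  have hc0 : 0 < c := by positivity
  set K : ℝ := (√c)⁻¹ ^ n with hK
  have hK0 : 0 < K := by positivity
  obtain ⟨a, ha_def⟩ : ∃ a : (Fin n → ℝ) → ℝ,
      a = fun z => Real.exp (ρ * s / 2 * ∑ t, z t ^ 2) := ⟨_, rfl⟩
  obtain ⟨β, hβ_def⟩ : ∃ β : (Fin n → ℝ) → ℝ,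
      β = fun y => K * Real.exp (-(s / c / 2) * ∑ t, y t ^ 2) := ⟨_, rfl⟩
  obtain ⟨b, hb_def⟩ : ∃ b : (Fin n → ℝ) → (Fin n → ℝ) → ℝ,
      b = fun y x' => Real.exp (-(s / 2) * ∑ t, (y t - x' t) ^ 2) := ⟨_, rfl⟩
  -- `β y` is the mean of `b y x'` over a competitor `x'`, so `N * β (z + x)` is the mean of the sum
  -- over `T`. `A` and `B` come from the slope and intercept of the tangent to `t ↦ t ^ ρ` there,
  -- the intercept being shared among the `N` summands. The tangent replaces Jensen's inequality:
  -- the bound becomes linear in the competitors, so only the joint law of `w` with each single `w'`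
  -- matters.
  obtain ⟨A, hA_def⟩ : ∃ A : (Fin n → ℝ) → (Fin n → ℝ) → ℝ,
      A = fun z x => a z * (ρ * (N * β (z + x)) ^ (ρ - 1)) := ⟨_, rfl⟩
  obtain ⟨B, hB_def⟩ : ∃ B : (Fin n → ℝ) → (Fin n → ℝ) → ℝ,
      B = fun z x => a z * ((1 - ρ) * (N * β (z + x)) ^ ρ / N) := ⟨_, rfl⟩
  have ha : ∀ z, 0 < a z := fun z => by rw [ha_def]; exact Real.exp_pos _
  have hβ : ∀ y, 0 < β y := fun y => by rw [hβ_def]; positivity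
  have hb : ∀ y x', 0 < b y x' := fun y x' => by rw [hb_def]; exact Real.exp_pos _
  have hA : ∀ z x, 0 ≤ A z x := fun z x => by
    have := hβ (z + x); have := ha z; rw [hA_def]; positivity
  have hB : ∀ z x, 0 ≤ B z x := fun z x => by
    have := hβ (z + x); have := ha z; have : 0 ≤ 1 - ρ := by linarith
    rw [hB_def]; positivity
  have ham : Measurable a := by rw [ha_def]; fun_prop
  have hβm : Measurable β := by rw [hβ_def]; fun_prop
  have hbm : Measurable fun p : (Fin n → ℝ) × (Fin n → ℝ) => b p.1 p.2 := by
    rw [hb_def]; fun_prop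
  have hAm : Measurable fun p : (Fin n → ℝ) × (Fin n → ℝ) => A p.1 p.2 := by
    rw [hA_def]
    exact (ham.comp measurable_fst).mul ((((hβm.comp (measurable_fst.add measurable_snd)).const_mul
      N).pow_const (ρ - 1)).const_mul ρ)
  have hBm : Measurable fun p : (Fin n → ℝ) × (Fin n → ℝ) => B p.1 p.2 := by
    rw [hB_def]
    exact (ham.comp measurable_fst).mul (((((hβm.comp (measurable_fst.add measurable_snd)).const_mul
      N).pow_const ρ).const_mul (1 - ρ)).div_const N)
  obtain ⟨H, hH_def⟩ : ∃ H : (Fin n → ℝ) → (Fin n → ℝ) → (Fin n → ℝ) → ENNReal,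
      H = fun z x x' => ENNReal.ofReal (A z x * b (z + x) x' + B z x) := ⟨_, rfl⟩
  have hHm : Measurable fun p : (Fin n → ℝ) × (Fin n → ℝ) × (Fin n → ℝ) =>
      H p.1 p.2.1 p.2.2 := by
    rw [hH_def]
    exact ENNReal.measurable_ofReal.comp (((hAm.comp (measurable_fst.prodMk measurable_snd.fst)).mul
      (hbm.comp ((measurable_fst.add measurable_snd.fst).prodMk measurable_snd.snd))).add
      (hBm.comp (measurable_fst.prodMk measurable_snd.fst)))
  have hinner : ∀ z x, ∫⁻ x', H z x x' ∂iidGaussian n V =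
      ENNReal.ofReal (N ^ ρ / N) * ENNReal.ofReal (a z * β (z + x) ^ ρ) := by
    intro z x
    have hb' : Measurable (b (z + x)) := hbm.comp measurable_prodMk_left
    simp only [hH_def]
    simp_rw [fun x' => ENNReal.ofReal_add (mul_nonneg (hA z x) (hb (z + x) x').le) (hB z x),
      fun x' => ENNReal.ofReal_mul (q := b (z + x) x') (hA z x)]
    rw [lintegral_add_right _ measurable_const, lintegral_const, measure_univ, mul_one,
      lintegral_const_mul _ hb'.ennreal_ofReal]
    have e : ∫⁻ x', ENNReal.ofReal (b (z + x) x') ∂iidGaussian n V =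
        ENNReal.ofReal (β (z + x)) := by
      rw [hb_def, hβ_def]
      exact lintegral_exp_sub_sq_iidGaussian V s (z + x) hc0
    rw [e, ← ENNReal.ofReal_mul (hA z x), ← ENNReal.ofReal_add
      (mul_nonneg (hA z x) (hβ _).le) (hB z x), ← ENNReal.ofReal_mul (by positivity)]
    congr 1
    have hNβ : 0 < N * β (z + x) := mul_pos hN (hβ _)
    have e2 : (N * β (z + x)) ^ (ρ - 1) * β (z + x) = (N * β (z + x)) ^ ρ / N := by
      rw [Real.rpow_sub_one hNβ.ne']
      have := (hβ (z + x)).ne'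
      field_simp
    have e3 : (N * β (z + x)) ^ ρ = N ^ ρ * β (z + x) ^ ρ :=
      Real.mul_rpow hN.le (hβ _).le
    simp only [hA_def, hB_def]
    rw [show a z * (ρ * (N * β (z + x)) ^ (ρ - 1)) * β (z + x) =
      a z * ρ * ((N * β (z + x)) ^ (ρ - 1) * β (z + x)) by ring, e2, e3]
    ring
  have htriple : ∫⁻ z, ∫⁻ x, ∫⁻ x', H z x x' ∂iidGaussian n V ∂iidGaussian n V ∂noise n =
      ENNReal.ofReal (N ^ ρ / N) * ENNReal.ofReal (K ^ ρ) := by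
    have hm : Measurable fun p : (Fin n → ℝ) × (Fin n → ℝ) =>
        ENNReal.ofReal (a p.1 * β (p.1 + p.2) ^ ρ) :=
      ENNReal.measurable_ofReal.comp ((ham.comp measurable_fst).mul
        ((hβm.comp (measurable_fst.add measurable_snd)).pow_const ρ))
    simp_rw [hinner]
    have e : ∀ z, ∫⁻ x, ENNReal.ofReal (N ^ ρ / N) * ENNReal.ofReal (a z * β (z + x) ^ ρ)
        ∂iidGaussian n V = ENNReal.ofReal (N ^ ρ / N) *
          ∫⁻ x, ENNReal.ofReal (a z * β (z + x) ^ ρ) ∂iidGaussian n V := fun z =>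
      lintegral_const_mul _ (hm.comp measurable_prodMk_left)
    simp_rw [e]
    rw [lintegral_const_mul _ hm.lintegral_prod_right']
    congr 1
    rw [ha_def, hβ_def]
    exact lintegral_gallager V hρ
  have hGm : ∀ w' : Fin l → Fin (M + 1),
      Measurable fun p : (Fin l → Fin (M + 1) → Fin n → ℝ) × (Fin n → ℝ) =>
        H p.2 (superposition S w p.1) (superposition S w' p.1) := fun w' =>
    hHm.comp (measurable_snd.prodMk
      (((ContinuousLinearMap.measurable _).comp measurable_fst).prodMk
        ((ContinuousLinearMap.measurable _).comp measurable_fst)))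
  calc _ ≤ ∫⁻ p, ∑ w' ∈ T, H p.2 (superposition S w p.1) (superposition S w' p.1)
          ∂((gaussianCodebooks l M n Q).prod (noise n)) := by
        refine (measure_mono ?_).trans ((one_mul _).symm.trans_le (mul_meas_ge_le_lintegral₀
          (Finset.measurable_fun_sum T fun w' _ => hGm w').aemeasurable 1))
        rintro ⟨cb, z⟩ ⟨w', hw'T, hle⟩
        simp only at hle
        set x := superposition S w cb with hx
        rw [Set.mem_ofPred_eq]
        simp only [hH_def]
        rw [← ENNReal.ofReal_sum_of_nonneg fun w' _ =>
          add_nonneg (mul_nonneg (hA z x) (hb _ _).le) (hB z x), ENNReal.one_le_ofReal]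
        set t := ∑ w' ∈ T, b (z + x) (superposition S w' cb) with ht
        have ht0 : b (z + x) (superposition S w' cb) ≤ t :=
          Finset.single_le_sum (f := fun w' => b (z + x) (superposition S w' cb))
            (fun _ _ => (hb _ _).le) hw'T
        have htpos : 0 < t := (hb _ _).trans_le ht0
        have h1 : Real.exp (-(s / 2) * ∑ t, z t ^ 2) ≤ t := by
          refine le_trans ?_ ht0
          rw [hb_def]
          refine Real.exp_le_exp.2 ?_
          have : ∑ t, ((z + x) t - superposition S w' cb t) ^ 2 ≤ ∑ t, z t ^ 2 := hle
          nlinarith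
        -- Gallager's indicator bound: if one tilted likelihood ratio is at least one, so is the
        -- `ρ`-th power of their sum.
        have h2 : 1 ≤ a z * t ^ ρ := by
          have := Real.rpow_le_rpow (Real.exp_pos _).le h1 hρ.le
          rw [← Real.exp_mul] at this
          refine le_trans ?_ (mul_le_mul_of_nonneg_left this (ha z).le)
          rw [ha_def, ← Real.exp_add, Real.one_le_exp_iff]
          apply le_of_eq
          ring
        refine h2.trans ((mul_le_mul_of_nonneg_left
          (rpow_le_tangent hρ hρ1 htpos.le (mul_pos hN (hβ (z + x)))) (ha z).le).trans
          (le_of_eq ?_))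
        rw [Finset.sum_add_distrib, ← Finset.mul_sum, ← ht, Finset.sum_const, nsmul_eq_mul,
          ← hNdef]
        simp only [hA_def, hB_def]
        field_simp
    _ = ∑ w' ∈ T, ∫⁻ z, ∫⁻ x, ∫⁻ x', H z x x' ∂iidGaussian n V ∂iidGaussian n V ∂noise n := by
        rw [lintegral_finsetSum _ fun w' _ => hGm w']
        refine Finset.sum_congr rfl fun w' hw'T => ?_
        rw [lintegral_prod_symm' _ (hGm w')]
        refine lintegral_congr fun z => ?_
        exact lintegral_superposition Q S w w' hw (hT w' hw'T) (hne w' hw'T) (H z)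
          (hHm.comp measurable_prodMk_left)
    _ = ENNReal.ofReal (N ^ ρ * K ^ ρ) := by
        rw [htriple, Finset.sum_const, nsmul_eq_mul, ← ENNReal.ofReal_natCast, ← hNdef,
          ← ENNReal.ofReal_mul (by positivity), ← ENNReal.ofReal_mul (by positivity)]
        congr 1
        field_simp

/-! ### Union bound over the sets of wrongly decoded users -/

lemma mem_messages {l M : ℕ} {A : Finset (Fin l)} {w : Fin l → Fin (M + 1)} :
    w ∈ messages M A ↔ (∀ i ∈ A, w i ≠ 0) ∧ ∀ i ∉ A, w i = 0 := by
  simp only [messages, Fintype.mem_piFinset]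
  constructor
  · intro h
    refine ⟨fun i hi => ?_, fun i hi => ?_⟩
    · have := h i; simpa [hi] using this
    · have := h i; simpa [hi] using this
  · rintro ⟨h1, h2⟩ i
    by_cases hi : i ∈ A
    · simpa [hi] using h1 i hi
    · simpa [hi] using h2 i hi

lemma card_messages {l M : ℕ} (A : Finset (Fin l)) : (messages M A).card = M ^ A.card := by
  rw [messages, Fintype.card_piFinset]
  have : ∀ i : Fin l, (if i ∈ A then Finset.univ.erase (0 : Fin (M + 1)) else {0}).card =
      if i ∈ A then M else 1 := by
    intro i; split_ifs <;> simp
  simp_rw [this]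
  rw [Finset.prod_ite_mem, Finset.univ_inter, Finset.prod_const]

/-- The set of users for which two message vectors differ. -/
def diffUsers {l M : ℕ} (w w' : Fin l → Fin (M + 1)) : Finset (Fin l) :=
  Finset.univ.filter fun i => w i ≠ w' i

/-- On `S` both `0` and the true message are excluded. Having `M - 1` rather than `M` choices later
absorbs the rounding in `⌈exp v⌉₊`. -/
lemma card_filter_diffUsers_le {l M : ℕ} {A : Finset (Fin l)} {w : Fin l → Fin (M + 1)}
    (hw : w ∈ messages M A) {S : Finset (Fin l)} (hS : S ⊆ A) :
    ((messages M A).filter fun w' => diffUsers w w' = S).card ≤ (M - 1) ^ S.card := by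
  have hw0 := mem_messages.1 hw
  calc _ ≤ (Fintype.piFinset fun i =>
          if i ∈ S then (Finset.univ.erase (0 : Fin (M + 1))).erase (w i) else {w i}).card := by
        refine Finset.card_le_card fun w' hw' => ?_
        rw [Finset.mem_filter] at hw'
        have hw1 := mem_messages.1 hw'.1
        rw [Fintype.mem_piFinset]
        intro i
        have h1 : i ∈ diffUsers w w' ↔ w i ≠ w' i := by simp [diffUsers]
        rw [hw'.2] at h1
        by_cases hi : i ∈ S
        · have h2 := h1.1 hi
          have h3 := hw1.1 i (hS hi)
          simp [hi, h3, h2.symm]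
        · have h2 := not_not.1 (mt h1.2 hi)
          simp [hi, h2]
    _ = (M - 1) ^ S.card := by
        rw [Fintype.card_piFinset]
        have : ∀ i : Fin l, (if i ∈ S then (Finset.univ.erase (0 : Fin (M + 1))).erase (w i)
            else {w i}).card = if i ∈ S then M - 1 else 1 := by
          intro i
          split_ifs with hi
          · rw [Finset.card_erase_of_mem (by simp [hw0.1 i (hS hi)])]; simp
          · simp
        simp_rw [this]
        rw [Finset.prod_ite_mem, Finset.univ_inter, Finset.prod_const]

lemma measurePreserving_codeword {l M n : ℕ} (Q : ℝ≥0) (i : Fin l) (m : Fin (M + 1)) :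
    MeasurePreserving (fun s : Fin l → Fin (M + 1) → Fin n → ℝ => s i m)
      (gaussianCodebooks l M n Q) (iidGaussian n (if m = 0 then 0 else Q)) :=
  (measurePreserving_eval (fun m : Fin (M + 1) =>
    iidGaussian n (if m = 0 then 0 else Q)) m).comp
    (measurePreserving_eval (fun _ : Fin l => Measure.pi fun m : Fin (M + 1) =>
      iidGaussian n (if m = 0 then 0 else Q)) i)

/-- Variance `0` makes these codewords vanish only almost surely, whereas a code needs it exactly;
the null set is avoided when a codebook is selected. -/
lemma ae_codeword_zero {l M n : ℕ} (Q : ℝ≥0) :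
    ∀ᵐ s ∂gaussianCodebooks l M n Q, ∀ i, s i 0 = 0 := by
  rw [ae_all_iff]
  intro i
  have h : ∀ᵐ x ∂iidGaussian n 0, x = 0 := by
    have : ∀ᵐ x ∂iidGaussian n 0, ∀ t, x t = 0 := by
      rw [ae_all_iff]
      intro t
      refine (measurePreserving_eval (fun _ : Fin n => gaussianReal 0 0)
        t).quasiMeasurePreserving.ae (p := fun y => y = 0) ?_
      rw [gaussianReal_zero_var, ae_dirac_eq]
      exact rfl
    filter_upwards [this] with x hx
    exact funext hx
  have h1 := measurePreserving_codeword (n := n) Q i (0 : Fin (M + 1))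
  simp only [if_true] at h1
  exact h1.quasiMeasurePreserving.ae h

/-- A transmission with maximum likelihood decoding fails only if some vector of messages that is
at least as likely as the transmitted one differs from it for exactly the users in some nonempty
set of active users, or if a codeword violates the power constraint. -/
lemma mlFailure_cases {l M n : ℕ} {P : ℝ} (hP : 0 < P) {s : Fin l → Fin (M + 1) → Fin n → ℝ}
    {A : Finset (Fin l)} {w : Fin l → Fin (M + 1)} (hw : w ∈ messages M A) {z : Fin n → ℝ}
    (hs : ∀ i, s i 0 = 0) (h : MLFailure P s A w z) :
    (∃ S ∈ A.powerset.erase ∅, ∃ w' ∈ (messages M A).filter fun w' => diffUsers w w' = S,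
      ∑ t, (z t + superposition S w s t - superposition S w' s t) ^ 2 ≤ ∑ t, z t ^ 2) ∨
    ∃ i ∈ A, P < (1 / (n : ℝ)) * ∑ t, s i (w i) t ^ 2 := by
  have hw0 := mem_messages.1 hw
  rcases h with ⟨w', ⟨hw', hle⟩, hne⟩ | ⟨i, hi⟩
  · left
    have hw1 := mem_messages.1 hw'
    refine ⟨diffUsers w w', ?_, w', by simp [hw'], ?_⟩
    · rw [Finset.mem_erase, Finset.mem_powerset]
      constructor
      · intro h
        refine hne (funext fun i => ?_)
        by_contra h2
        have : i ∈ diffUsers w w' := by simp [diffUsers, Ne.symm h2]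
        simp [h] at this
      · intro i hi
        by_contra h2
        simp [diffUsers, hw0.2 i h2, hw1.2 i h2] at hi
    · have h1 := hle w hw
      have e1 : ∀ t, received s w z t - ∑ i, s i (w i) t = z t := by
        intro t; simp [received]
      have e2 : ∀ t, received s w z t - ∑ i, s i (w' i) t =
          z t + superposition (diffUsers w w') w s t - superposition (diffUsers w w') w' s t := by
        intro t
        have : ∑ i, s i (w i) t - ∑ i, s i (w' i) t =
            ∑ i ∈ diffUsers w w', s i (w i) t - ∑ i ∈ diffUsers w w', s i (w' i) t := by
          rw [← Finset.sum_sub_distrib, ← Finset.sum_sub_distrib, diffUsers, Finset.sum_filter]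
          refine Finset.sum_congr rfl fun i _ => ?_
          split_ifs with h
          · rfl
          · rw [not_not.1 h, sub_self]
        simp only [received, superposition_apply, Pi.add_apply, Finset.sum_apply]
        linarith
      simp_rw [e1, e2] at h1
      exact h1
  · right
    by_cases hiA : i ∈ A
    · exact ⟨i, hiA, hi⟩
    · rw [hw0.2 i hiA, hs] at hi
      simp at hi
      linarith

/-- The random coding bound for the probability of failure when `k` users are active. -/
noncomputable def codingBound (k M n : ℕ) (P Q ρ : ℝ) : ℝ :=
  ∑ j ∈ Finset.range (k + 1), (k.choose j : ℝ) * (if j = 0 then 0 else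
    (((M - 1 : ℕ) : ℝ) ^ j) ^ ρ * ((√(1 + 1 / (1 + ρ) * (j * Q)))⁻¹ ^ n) ^ ρ) +
  k * √(P / Q * Real.exp (1 - P / Q)) ^ n

/-- Union bound over the nonempty `S ⊆ A` and over the codewords of the active users. The result
depends on `A` only through its size and not on `w`. -/
lemma measureReal_mlFailure_le {l M n : ℕ} {P : ℝ} {Q : ℝ≥0} (hQ : 0 < Q) (hQP : (Q : ℝ) < P)
    (hn : 0 < n) {A : Finset (Fin l)} {w : Fin l → Fin (M + 1)} (hw : w ∈ messages M A)
    {ρ : ℝ} (hρ : 0 < ρ) (hρ1 : ρ ≤ 1) :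
    ((gaussianCodebooks l M n Q).prod (noise n)).real {x | MLFailure P x.1 A w x.2} ≤
      codingBound A.card M n P Q ρ := by
  set μ := (gaussianCodebooks l M n Q).prod (noise n) with hμ
  have hw0 := mem_messages.1 hw
  have hP : 0 < P := lt_trans hQ hQP
  set E : Finset (Fin l) → Set ((Fin l → Fin (M + 1) → Fin n → ℝ) × (Fin n → ℝ)) := fun S =>
    {x | ∃ w' ∈ (messages M A).filter fun w' => diffUsers w w' = S,
      ∑ t, (x.2 t + superposition S w x.1 t - superposition S w' x.1 t) ^ 2 ≤ ∑ t, x.2 t ^ 2}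
    with hE
  set G : Fin l → Set ((Fin l → Fin (M + 1) → Fin n → ℝ) × (Fin n → ℝ)) := fun i =>
    {x | P < (1 / (n : ℝ)) * ∑ t, x.1 i (w i) t ^ 2} with hG
  have hsub : {x : (Fin l → Fin (M + 1) → Fin n → ℝ) × (Fin n → ℝ) | MLFailure P x.1 A w x.2} ≤ᵐ[μ]
      ((⋃ S ∈ A.powerset.erase ∅, E S) ∪ ⋃ i ∈ A, G i : Set _) := by
    have h0 : ∀ᵐ x ∂μ, ∀ i, x.1 i 0 = 0 :=
      (Measure.quasiMeasurePreserving_fst (μ := gaussianCodebooks l M n Q)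
        (ν := noise n)).ae (ae_codeword_zero Q)
    filter_upwards [h0] with x hx hfail
    rcases mlFailure_cases hP hw hx hfail with ⟨S, hS, h⟩ | ⟨i, hi, h⟩
    · exact Or.inl (Set.mem_biUnion (t := E) hS h)
    · exact Or.inr (Set.mem_biUnion (t := G) hi h)
  have hES : ∀ S ∈ A.powerset.erase ∅, μ.real (E S) ≤ (((M - 1 : ℕ) : ℝ) ^ S.card) ^ ρ *
      ((√(1 + 1 / (1 + ρ) * (S.card * Q)))⁻¹ ^ n) ^ ρ := by
    intro S hS
    rw [Finset.mem_erase, Finset.mem_powerset] at hS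
    have h := gallager_bound (n := n) Q S w ((messages M A).filter fun w' => diffUsers w w' = S)
      (fun i hi => hw0.1 i (hS.2 hi))
      (fun w' hw' i hi => (mem_messages.1 (Finset.mem_filter.1 hw').1).1 i (hS.2 hi))
      (fun w' hw' i hi => by
        rw [← (Finset.mem_filter.1 hw').2] at hi
        simpa [diffUsers] using hi) hρ hρ1
    refine (ENNReal.toReal_le_of_le_ofReal (by positivity) h).trans ?_
    have hc := card_filter_diffUsers_le hw hS.2
    have hc' : (((messages M A).filter fun w' => diffUsers w w' = S).card : ℝ) ≤
        ((M - 1 : ℕ) : ℝ) ^ S.card := by exact_mod_cast hc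
    push_cast
    gcongr
  have hGi : ∀ i ∈ A, μ.real (G i) ≤ √(P / Q * Real.exp (1 - P / Q)) ^ n := by
    intro i hi
    have h1 := (measurePreserving_codeword (n := n) Q i (w i)).comp
      (measurePreserving_fst (μ := gaussianCodebooks l M n Q) (ν := noise n))
    rw [if_neg (hw0.1 i hi)] at h1
    have hm : MeasurableSet {x : Fin n → ℝ | P < (1 / (n : ℝ)) * ∑ t, x t ^ 2} :=
      measurableSet_lt measurable_const (by fun_prop)
    have h2 := h1.measure_preimage hm.nullMeasurableSet
    refine ENNReal.toReal_le_of_le_ofReal (by positivity) ?_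
    exact h2.trans_le (iidGaussian_norm_gt_le hQ hQP hn)
  have hμle : μ.real {x | MLFailure P x.1 A w x.2} ≤
      μ.real ((⋃ S ∈ A.powerset.erase ∅, E S) ∪ ⋃ i ∈ A, G i) :=
    ENNReal.toReal_mono (measure_ne_top _ _) (measure_mono_ae hsub)
  refine hμle.trans ((measureReal_union_le _ _).trans ?_)
  unfold codingBound
  refine add_le_add ((measureReal_biUnion_finset_le _ _).trans
    ((Finset.sum_le_sum hES).trans (le_of_eq ?_)))
    ((measureReal_biUnion_finset_le _ _).trans ((Finset.sum_le_sum hGi).trans (le_of_eq ?_)))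
  -- Grouping the sets `S` by size produces the binomial coefficients; the value `0` at `j = 0`
  -- stands for the omitted empty set.
  · have h := Finset.sum_powerset_apply_card (fun j : ℕ => if j = 0 then (0 : ℝ) else
      (((M - 1 : ℕ) : ℝ) ^ j) ^ ρ * ((√(1 + 1 / (1 + ρ) * (j * Q)))⁻¹ ^ n) ^ ρ) (x := A)
    simp only [nsmul_eq_mul] at h
    rw [← h, ← Finset.add_sum_erase A.powerset _ (Finset.empty_mem_powerset A)]
    simp only [Finset.card_empty, if_true, zero_add]
    refine Finset.sum_congr rfl fun S hS => ?_
    rw [if_neg (Finset.card_ne_zero.2 (Finset.nonempty_iff_ne_empty.2 (Finset.ne_of_mem_erase hS)))]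
  · rw [Finset.sum_const, nsmul_eq_mul]

/-- Averages over the messages and over the set of active users preserve a uniform bound. -/
lemma average_le {l M k : ℕ} (hM : 0 < M) (π : PMF (Finset (Fin l)))
    (hπ : ∀ A ∈ π.support, A.card = k)
    (f : Finset (Fin l) → (Fin l → Fin (M + 1)) → ℝ) (B : ℝ)
    (hf : ∀ A, A.card = k → (∑ w ∈ messages M A, f A w) ≤ B * (M : ℝ) ^ k) :
    ∑ A, (π A).toReal * ((∑ w ∈ messages M A, f A w) / (M : ℝ) ^ A.card) ≤ B := by
  have hM0 : (0 : ℝ) < M := by exact_mod_cast hM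
  have h1 : ∑ A, (π A).toReal = 1 := by
    have h2 := π.tsum_coe
    rw [tsum_fintype] at h2
    rw [← ENNReal.toReal_sum fun A _ => π.apply_ne_top A, h2, ENNReal.toReal_one]
  calc _ ≤ ∑ A, (π A).toReal * B := by
        refine Finset.sum_le_sum fun A _ => ?_
        by_cases hA : A ∈ π.support
        · refine mul_le_mul_of_nonneg_left ?_ ENNReal.toReal_nonneg
          rw [hπ A hA, div_le_iff₀ (by positivity)]
          exact hf A (hπ A hA)
        · rw [PMF.mem_support_iff, not_not] at hA
          simp [hA]
    _ = B := by rw [← Finset.sum_mul, h1, one_mul]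

lemma gaussianMLError_le {l M n k : ℕ} {P : ℝ} {Q : ℝ≥0} (hQ : 0 < Q) (hQP : (Q : ℝ) < P)
    (hn : 0 < n) (hM : 0 < M) (π : PMF (Finset (Fin l))) (hπ : ∀ A ∈ π.support, A.card = k)
    {ρ : ℝ} (hρ : 0 < ρ) (hρ1 : ρ ≤ 1) :
    gaussianMLError l M n P Q π ≤ codingBound k M n P Q ρ := by
  refine average_le hM π hπ _ _ fun A hA => ?_
  refine (Finset.sum_le_sum fun w hw => measureReal_mlFailure_le hQ hQP hn hw hρ hρ1).trans ?_
  rw [Finset.sum_const, card_messages, nsmul_eq_mul, hA, Nat.cast_pow, mul_comm]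

/-! ### Concavity and the asymptotics of the union bound -/

/-- The excess of the concave function `x ↦ log (1 + x q)` over its chord from `0` to `k`. -/
noncomputable def logExcess (q : ℝ) (k j : ℕ) : ℝ :=
  Real.log (1 + j * q) - (j / k : ℝ) * Real.log (1 + k * q)

/-- Concavity, with `j` written as a convex combination of `i`, `k` and `0` in which `i` has weight
`(k - j) / k`; the excess vanishes at `k` and at `0`. This weight makes the lower bound on the
exponent linear in `k - j`. -/
lemma logExcess_ge {q : ℝ} (hq : 0 < q) {i j k : ℕ} (hk : 0 < k) (hij : i ≤ j) (hjk : j ≤ k) :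
    ((k - j : ℕ) : ℝ) * logExcess q k i ≤ k * logExcess q k j := by
  have hk0 : (0 : ℝ) < k := by exact_mod_cast hk
  have hij' : (i : ℝ) ≤ j := by exact_mod_cast hij
  have hjk' : (j : ℝ) ≤ k := by exact_mod_cast hjk
  have hj0 : (0 : ℝ) ≤ j := j.cast_nonneg
  have hi0 : (0 : ℝ) ≤ i := i.cast_nonneg
  rw [Nat.cast_sub hjk]
  set w₁ : ℝ := (k - j) / k with hw₁
  set w₂ : ℝ := j / k - i * (k - j) / k ^ 2 with hw₂
  have h₁ : 0 ≤ w₁ := div_nonneg (sub_nonneg.2 hjk') hk0.le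
  have h₂ : 0 ≤ w₂ := by
    have : w₂ = (j * k - i * (k - j)) / k ^ 2 := by rw [hw₂]; field_simp
    rw [this]
    refine div_nonneg ?_ (by positivity)
    nlinarith [mul_nonneg hi0 hj0, mul_le_mul_of_nonneg_right hij' hk0.le]
  have h₃ : 0 ≤ 1 - w₁ - w₂ := by
    have : 1 - w₁ - w₂ = i * (k - j) / k ^ 2 := by rw [hw₁, hw₂]; field_simp; ring
    rw [this]
    exact div_nonneg (mul_nonneg hi0 (sub_nonneg.2 hjk')) (by positivity)
  have hpi : 0 < 1 + i * q := by positivity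
  have hpk : 0 < 1 + k * q := by positivity
  have h := Real.geom_mean_le_arith_mean3_weighted h₁ h₂ h₃ hpi.le hpk.le zero_le_one (by ring)
  have e : w₁ * (1 + i * q) + w₂ * (1 + k * q) + (1 - w₁ - w₂) * 1 = 1 + j * q := by
    rw [hw₁, hw₂]; field_simp; ring
  rw [e, Real.one_rpow, mul_one] at h
  have h' := Real.log_le_log (mul_pos (Real.rpow_pos_of_pos hpi _) (Real.rpow_pos_of_pos hpk _)) h
  rw [Real.log_mul (Real.rpow_pos_of_pos hpi _).ne' (Real.rpow_pos_of_pos hpk _).ne',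
    Real.log_rpow hpi, Real.log_rpow hpk] at h'
  have h'' := mul_le_mul_of_nonneg_left h' hk0.le
  have e2 : (k : ℝ) * (w₁ * Real.log (1 + i * q) + w₂ * Real.log (1 + k * q)) =
      (k - j) * Real.log (1 + i * q) + (j - i * (k - j) / k) * Real.log (1 + k * q) := by
    rw [hw₁, hw₂]; field_simp
  rw [e2] at h''
  unfold logExcess
  have e3 : ((k : ℝ) - j) * (Real.log (1 + i * q) - i / k * Real.log (1 + k * q)) =
      (k - j) * Real.log (1 + i * q) - (i * (k - j) / k) * Real.log (1 + k * q) := by ring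
  have e4 : (k : ℝ) * (Real.log (1 + j * q) - j / k * Real.log (1 + k * q)) =
      k * Real.log (1 + j * q) - j * Real.log (1 + k * q) := by field_simp
  rw [e3, e4]
  linarith

lemma logExcess_nonneg {q : ℝ} (hq : 0 < q) {j k : ℕ} (hk : 0 < k) (hjk : j ≤ k) :
    0 ≤ logExcess q k j := by
  have h := logExcess_ge hq hk (Nat.zero_le j) hjk
  have h0 : logExcess q k 0 = 0 := by simp [logExcess]
  rw [h0, mul_zero] at h
  have hk0 : (0 : ℝ) < k := by exact_mod_cast hk
  exact nonneg_of_mul_nonneg_right h hk0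

/-- The union bound over the number `j` of users with a wrong message, in exponential form; the
exponent has been bounded from below, and `r` stands for `ρ * n / 2`. -/
noncomputable def exponentSum (q η r : ℝ) (k : ℕ) : ℝ :=
  ∑ j ∈ Finset.range (k + 1), (k.choose j : ℝ) *
    if j = 0 then 0 else Real.exp (-(r * (logExcess q k j + (j / k : ℝ) * η)))

lemma exponentSum_nonneg (q η r : ℝ) (k : ℕ) : 0 ≤ exponentSum q η r k :=
  Finset.sum_nonneg fun j _ => mul_nonneg (Nat.cast_nonneg _) (by split_ifs <;> positivity)

/-- The regime of bounded `k`: the binomial coefficients sum to at most `2 ^ K`, and `j ≥ 1` alone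
gives a fixed fraction of `η`. -/
lemma exponentSum_le_of_le {q η r : ℝ} (hq : 0 < q) (hη : 0 < η) (hr : 0 ≤ r) {k K : ℕ}
    (hk : 0 < k) (hkK : k ≤ K) : exponentSum q η r k ≤ 2 ^ K * Real.exp (-(r * (η / K))) := by
  have hk0 : (0 : ℝ) < k := by exact_mod_cast hk
  have hkK' : (k : ℝ) ≤ K := by exact_mod_cast hkK
  calc exponentSum q η r k ≤ ∑ j ∈ Finset.range (k + 1), (k.choose j : ℝ) *
        Real.exp (-(r * (η / K))) := by
        refine Finset.sum_le_sum fun j hj => mul_le_mul_of_nonneg_left ?_ (Nat.cast_nonneg _)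
        split_ifs with h0
        · positivity
        · have hj1 : (1 : ℝ) ≤ j := by exact_mod_cast Nat.one_le_iff_ne_zero.2 h0
          rw [Real.exp_le_exp, neg_le_neg_iff]
          refine mul_le_mul_of_nonneg_left ?_ hr
          have h1 := logExcess_nonneg hq hk (Nat.lt_succ_iff.1 (Finset.mem_range.1 hj))
          have h2 : η / K ≤ j / k * η := by
            calc η / K ≤ η / k := by gcongr
              _ = 1 / k * η := by ring
              _ ≤ j / k * η := by gcongr
          linarith
    _ = 2 ^ k * Real.exp (-(r * (η / K))) := by
        rw [← Finset.sum_mul]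
        congr 1
        exact_mod_cast Nat.sum_range_choose k
    _ ≤ 2 ^ K * Real.exp (-(r * (η / K))) := by
        gcongr
        norm_num

lemma tendsto_mul_log_div {q : ℝ} (hq : 0 < q) (i : ℝ) :
    Tendsto (fun k : ℕ => i / k * Real.log (1 + k * q)) atTop (𝓝 0) := by
  have h1 : Tendsto (fun x : ℝ => Real.log x / (x - 1)) atTop (𝓝 0) := by
    have := Real.tendsto_pow_log_div_mul_add_atTop 1 (-1) 1 one_ne_zero
    simpa [sub_eq_add_neg] using this
  have h2 : Tendsto (fun k : ℕ => 1 + (k : ℝ) * q) atTop atTop :=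
    tendsto_atTop_add_const_left _ _ (tendsto_natCast_atTop_atTop.atTop_mul_const hq)
  have h3 := (h1.comp h2).const_mul (i * q)
  rw [mul_zero] at h3
  refine h3.congr fun k => ?_
  simp only [Function.comp]
  rw [add_sub_cancel_left]
  rcases eq_or_ne (k : ℝ) 0 with h | h
  · simp [h]
  · field_simp

/-- The regime of large `k`, uniform in `r ≥ κ * k`. For `1 ≤ j < J` the binomial coefficient is at
most `k ^ J`, while the excess stays above a constant, giving a factor `exp (-κ p k)`. For `j ≥ J`,
`logExcess_ge` with `i = J` gives a factor `a ^ (k - j)` and the slack `η` a factor `b ^ j`, so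
these terms are bounded by those of the binomial expansion of `(a + b) ^ k`. -/
lemma exists_exponentSum_bound {q η κ : ℝ} (hq : 0 < q) (hη : 0 < η) (hκ : 0 < κ) :
    ∃ F : ℕ → ℝ, Tendsto F atTop (𝓝 0) ∧
      ∀ᶠ k : ℕ in atTop, ∀ r, κ * k ≤ r → exponentSum q η r k ≤ F k := by
  set b : ℝ := Real.exp (-(κ * η)) with hb
  have hb1 : b < 1 := by rw [hb, Real.exp_lt_one_iff]; nlinarith [mul_pos hκ hη]
  have hb0 : 0 < b := Real.exp_pos _
  -- Since `b < 1` is fixed beforehand, `J` can be taken so large that `a + b ≤ (1 + b) / 2 < 1`.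
  have hJ : ∀ᶠ J : ℕ in atTop, Real.exp (-(κ * (Real.log (1 + J * q) / 2))) < (1 - b) / 2 := by
    have h2 : Tendsto (fun k : ℕ => 1 + (k : ℝ) * q) atTop atTop :=
      tendsto_atTop_add_const_left _ _ (tendsto_natCast_atTop_atTop.atTop_mul_const hq)
    have h3 := Real.tendsto_exp_neg_atTop_nhds_zero.comp
      (((Real.tendsto_log_atTop.comp h2).atTop_div_const two_pos).const_mul_atTop hκ)
    exact h3.eventually_lt_const (by linarith)
  obtain ⟨J, hJ, hJ1⟩ := (hJ.and (eventually_ge_atTop 1)).exists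
  -- For `j < J` and large `k` the chord is below one half of `log (1 + q)`; the other half bounds
  -- the excess.
  set p : ℝ := Real.log (1 + q) / 2 with hp
  have hp0 : 0 < p := by
    have := Real.log_pos (show 1 < 1 + q by linarith)
    positivity
  set a : ℝ := Real.exp (-(κ * (Real.log (1 + J * q) / 2))) with ha
  have hmono : ∀ j : ℕ, 1 ≤ j → Real.log (1 + q) ≤ Real.log (1 + j * q) := by
    intro j hj
    refine Real.log_le_log (by positivity) ?_
    have : (1 : ℝ) ≤ j := by exact_mod_cast hj
    nlinarith
  refine ⟨fun k => J * ((k : ℝ) ^ J * Real.exp (-(κ * p) * k)) + ((1 + b) / 2) ^ k, ?_, ?_⟩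
  · have h1 : Tendsto (fun k : ℕ => (k : ℝ) ^ J * Real.exp (-(κ * p) * k)) atTop (𝓝 0) := by
      have := (tendsto_rpow_mul_exp_neg_mul_atTop_nhds_zero J (κ * p)
        (by positivity)).comp tendsto_natCast_atTop_atTop
      refine this.congr fun k => ?_
      simp
    have h2 : Tendsto (fun k : ℕ => ((1 + b) / 2) ^ k) atTop (𝓝 0) :=
      tendsto_pow_atTop_nhds_zero_of_lt_one (by positivity) (by linarith)
    have := (h1.const_mul (J : ℝ)).add h2
    simpa using this
  · filter_upwards [eventually_ge_atTop J,
      (tendsto_mul_log_div hq J).eventually_lt_const hp0] with k hkJ hlog r hr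
    have hk : 0 < k := lt_of_lt_of_le hJ1 hkJ
    have hk0 : (0 : ℝ) < k := by exact_mod_cast hk
    have hterm : ∀ j ∈ Finset.range (k + 1), (k.choose j : ℝ) *
        (if j = 0 then 0 else Real.exp (-(r * (logExcess q k j + (j / k : ℝ) * η)))) ≤
        (if j < J then (k : ℝ) ^ J * Real.exp (-(κ * p) * k) else 0) +
          b ^ j * a ^ (k - j) * (k.choose j : ℝ) := by
      intro j hj
      have hjk : j ≤ k := Nat.lt_succ_iff.1 (Finset.mem_range.1 hj)
      rcases Nat.eq_zero_or_pos j with h0 | h0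
      · simp only [h0, if_true, mul_zero]
        split_ifs <;> positivity
      rw [if_neg h0.ne']
      have hge : 0 ≤ logExcess q k j + (j / k : ℝ) * η :=
        add_nonneg (logExcess_nonneg hq hk hjk) (by positivity)
      have hexp : Real.exp (-(r * (logExcess q k j + (j / k : ℝ) * η))) ≤
          Real.exp (-(κ * (k * logExcess q k j + j * η))) := by
        rw [Real.exp_le_exp, neg_le_neg_iff]
        refine le_trans (le_of_eq ?_) (mul_le_mul_of_nonneg_right hr hge)
        field_simp
      by_cases hjJ : j < J
      · rw [if_pos hjJ]
        have h1 : (k.choose j : ℝ) ≤ (k : ℝ) ^ J := by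
          have : k.choose j ≤ k ^ J :=
            (Nat.choose_le_pow k j).trans (Nat.pow_le_pow_right hk hjJ.le)
          exact_mod_cast this
        have h2 : Real.exp (-(r * (logExcess q k j + (j / k : ℝ) * η))) ≤
            Real.exp (-(κ * p) * k) := by
          refine hexp.trans ?_
          rw [Real.exp_le_exp]
          have h3 : p ≤ logExcess q k j := by
            have h4 : (j / k : ℝ) * Real.log (1 + k * q) ≤ J / k * Real.log (1 + k * q) := by
              have : 0 ≤ Real.log (1 + k * q) := Real.log_nonneg (by nlinarith)
              gcongr
            have h5 := hmono j h0
            unfold logExcess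
            linarith
          have h6 : k * p ≤ k * logExcess q k j + j * η := by
            have : 0 ≤ (j : ℝ) * η := by positivity
            nlinarith
          nlinarith [mul_le_mul_of_nonneg_left h6 hκ.le]
        have h7 : 0 ≤ b ^ j * a ^ (k - j) * (k.choose j : ℝ) := by positivity
        have h8 := mul_le_mul h1 h2 (Real.exp_pos _).le (by positivity)
        linarith
      · rw [if_neg hjJ, zero_add, mul_comm]
        refine mul_le_mul_of_nonneg_right (hexp.trans (le_of_eq_of_le rfl ?_)) (Nat.cast_nonneg _)
        have h1 := logExcess_ge hq hk (not_lt.1 hjJ) hjk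
        have h2 : Real.log (1 + J * q) / 2 ≤ logExcess q k J := by
          have := hmono J hJ1
          unfold logExcess
          linarith
        have h3 := mul_le_mul_of_nonneg_left h2 (Nat.cast_nonneg (α := ℝ) (k - j))
        rw [hb, ha, ← Real.exp_nat_mul, ← Real.exp_nat_mul, ← Real.exp_add, Real.exp_le_exp]
        nlinarith [mul_le_mul_of_nonneg_left (h3.trans h1) hκ.le]
    refine (Finset.sum_le_sum hterm).trans ?_
    rw [Finset.sum_add_distrib, ← add_pow]
    refine add_le_add ?_ (pow_le_pow_left₀ (by positivity) (by linarith) _)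
    rw [← Finset.sum_filter, Finset.sum_const, nsmul_eq_mul]
    refine mul_le_mul_of_nonneg_right ?_ (by positivity)
    have : (Finset.filter (fun j => j < J) (Finset.range (k + 1))).card ≤ J := by
      refine (Finset.card_le_card (t := Finset.range J) fun j hj => ?_).trans
        (Finset.card_range J).le
      exact Finset.mem_range.2 (Finset.mem_filter.1 hj).2
    exact_mod_cast this

/-- As `k n` need neither converge nor diverge, each `n` is treated according to whether `k n` lies
below a threshold `K`. The bound `k n ≤ c * n` supplies `r ≥ κ * k` with `κ = ρ / (2 * c)`. -/
lemma tendsto_exponentSum {q η ρ : ℝ} (hq : 0 < q) (hη : 0 < η) (hρ : 0 < ρ) {k : ℕ → ℕ}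
    (hk : ∀ n, 0 < k n) (hkO : (fun n => (k n : ℝ)) =O[atTop] (fun n => (n : ℝ))) :
    Tendsto (fun n : ℕ => exponentSum q η (ρ * n / 2) (k n)) atTop (𝓝 0) := by
  obtain ⟨c, hc, hcO⟩ := hkO.exists_pos
  rw [IsBigOWith] at hcO
  obtain ⟨F, hF, hbound⟩ := exists_exponentSum_bound hq hη (κ := ρ / (2 * c)) (by positivity)
  rw [Metric.tendsto_nhds]
  intro ε hε
  obtain ⟨K, hK⟩ := eventually_atTop.1 ((hF.eventually_lt_const hε).and hbound)
  -- For `K = 0` the quotient `η / K` is `0` and gives no decay, but then `k n < K` never occurs.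
  have hsmall : Tendsto (fun n : ℕ => (2 : ℝ) ^ K * Real.exp (-(ρ * n / 2 * (η / K)))) atTop
      (𝓝 0) ∨ K = 0 := by
    rcases Nat.eq_zero_or_pos K with h0 | h0
    · exact Or.inr h0
    left
    have hK0 : (0 : ℝ) < K := by exact_mod_cast h0
    have h1 : Tendsto (fun n : ℕ => ρ * n / 2 * (η / K)) atTop atTop :=
      ((tendsto_natCast_atTop_atTop.const_mul_atTop hρ).atTop_div_const
        two_pos).atTop_mul_const (by positivity)
    simpa using (Real.tendsto_exp_neg_atTop_nhds_zero.comp h1).const_mul ((2 : ℝ) ^ K)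
  have hsmall' : ∀ᶠ n : ℕ in atTop, k n < K →
      (2 : ℝ) ^ K * Real.exp (-(ρ * n / 2 * (η / K))) < ε := by
    rcases hsmall with h | h
    · filter_upwards [h.eventually_lt_const hε] with n hn _ using hn
    · exact Eventually.of_forall fun n hn => by omega
  filter_upwards [hcO, hsmall'] with n hn hs
  rw [Real.dist_eq, sub_zero, abs_of_nonneg (exponentSum_nonneg _ _ _ _)]
  by_cases hnK : k n < K
  · exact (exponentSum_le_of_le hq hη (by positivity) (hk n) hnK.le).trans_lt (hs hnK)
  · refine ((hK _ (not_lt.1 hnK)).2 _ ?_).trans_lt (hK _ (not_lt.1 hnK)).1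
    simp only [Real.norm_natCast] at hn
    rw [div_mul_eq_mul_div, div_le_div_iff₀ (by positivity) two_pos]
    nlinarith

/-- The random coding bound vanishes as long as the message length stays below `C₁` by the factor
`1 - ε / log (1 + k P)` and the loss of power is small. -/
lemma tendsto_codingBound {P ε ρ : ℝ} {Q : ℝ≥0} (hP : 0 < P) (hε : 0 < ε) (hQ : 0 < Q)
    (hQP : (Q : ℝ) < P) (hρ : 0 < ρ) (hloss : Real.log (P / Q) + Real.log (1 + ρ) ≤ ε / 2)
    {k M : ℕ → ℕ} (hk : ∀ n, 0 < k n)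
    (hkO : (fun n => (k n : ℝ)) =O[atTop] (fun n => (n : ℝ)))
    (hM : ∀ n, ((M n - 1 : ℕ) : ℝ) ≤
      Real.exp (C₁ P (k n) n * (1 - ε / Real.log (1 + (k n : ℝ) * P)))) :
    Tendsto (fun n => codingBound (k n) (M n) n P Q ρ) atTop (𝓝 0) := by
  have hQ0 : (0 : ℝ) < Q := hQ
  -- The effective power in Gallager's exponent. Since `1 + k * P ≤ (1 + k * q) * (P / q)`, the loss
  -- is at most `log (P / q) ≤ ε / 2` for every `k`, and `η = ε / 2` is left over.
  set q : ℝ := Q / (1 + ρ) with hq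
  have hq0 : 0 < q := by positivity
  have hqP : q < P := (div_lt_self hQ0 (by linarith)).trans hQP
  have hPq : Real.log (P / q) ≤ ε / 2 := by
    have : P / q = P / Q * (1 + ρ) := by rw [hq]; field_simp
    rw [this, Real.log_mul (by positivity) (by positivity)]
    exact hloss
  have hx : P / Q * Real.exp (1 - P / Q) < 1 := by
    have h1 : 1 < P / Q := (one_lt_div hQ0).2 hQP
    have h2 := Real.add_one_lt_exp (x := P / Q - 1) (by linarith)
    have h3 : Real.exp (P / Q - 1) * Real.exp (1 - P / Q) = 1 := by
      rw [← Real.exp_add]; simp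
    have h4 : P / Q < Real.exp (P / Q - 1) := by linarith
    exact (mul_lt_mul_of_pos_right h4 (Real.exp_pos _)).trans_eq h3
  set x : ℝ := √(P / Q * Real.exp (1 - P / Q)) with hxdef
  have hx0 : 0 ≤ x := Real.sqrt_nonneg _
  have hx1 : x < 1 := by
    rw [hxdef, Real.sqrt_lt' one_pos]; simpa using hx
  have hpow : Tendsto (fun n => (k n : ℝ) * x ^ n) atTop (𝓝 0) :=
    (hkO.mul (isBigO_refl _ _)).trans_tendsto
      (tendsto_self_mul_const_pow_of_lt_one hx0 hx1)
  have hsum := (tendsto_exponentSum hq0 (half_pos hε) hρ hk hkO).add hpow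
  rw [add_zero] at hsum
  refine squeeze_zero (fun n => ?_) (fun n => ?_) hsum
  · unfold codingBound
    refine add_nonneg (Finset.sum_nonneg fun j _ => mul_nonneg (Nat.cast_nonneg _) ?_)
      (by positivity)
    split_ifs <;> positivity
  · unfold codingBound exponentSum
    refine add_le_add (Finset.sum_le_sum fun j hj =>
      mul_le_mul_of_nonneg_left ?_ (Nat.cast_nonneg _)) le_rfl
    split_ifs with h0
    · exact le_rfl
    have hk0 : (0 : ℝ) < k n := by exact_mod_cast hk n
    have hj0 : (0 : ℝ) < j := by exact_mod_cast Nat.pos_of_ne_zero h0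
    have hkP : 1 < 1 + (k n : ℝ) * P := by nlinarith [mul_pos hk0 hP]
    have hlogP := Real.log_pos hkP
    have hv : C₁ P (k n) n * (1 - ε / Real.log (1 + (k n : ℝ) * P)) =
        n / (2 * k n) * (Real.log (1 + k n * P) - ε) := by
      unfold C₁; field_simp
    have hlogPq : Real.log (1 + k n * P) ≤ Real.log (1 + k n * q) + ε / 2 := by
      have h1 : 1 + k n * P ≤ (1 + k n * q) * (P / q) := by
        have : (1 + k n * q) * (P / q) = P / q + k n * P := by field_simp
        rw [this]
        have := (one_lt_div hq0).2 hqP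
        linarith
      have h2 := Real.log_le_log (by positivity) h1
      rw [Real.log_mul (by positivity) (by positivity)] at h2
      linarith
    have h1 : (((M n - 1 : ℕ) : ℝ) ^ j) ^ ρ ≤
        Real.exp (ρ * (j * (n / (2 * k n) * (Real.log (1 + k n * P) - ε)))) := by
      rw [mul_comm ρ, Real.exp_mul, Real.exp_nat_mul, ← hv]
      have := hM n
      gcongr
    have h2 : ((√(1 + 1 / (1 + ρ) * (j * Q)))⁻¹ ^ n) ^ ρ =
        Real.exp (-(ρ * n / 2) * Real.log (1 + j * q)) := by
      have e : 1 + 1 / (1 + ρ) * (j * Q) = 1 + j * q := by rw [hq]; ring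
      rw [e]
      have hpos : 0 < 1 + (j : ℝ) * q := by positivity
      have e2 : (√(1 + j * q))⁻¹ = Real.exp (-(Real.log (1 + j * q) / 2)) := by
        rw [Real.exp_neg, Real.exp_half, Real.exp_log hpos]
      rw [e2, ← Real.exp_nat_mul, ← Real.exp_mul]
      congr 1
      ring
    rw [h2]
    refine (mul_le_mul_of_nonneg_right h1 (Real.exp_pos _).le).trans ?_
    rw [← Real.exp_add, Real.exp_le_exp]
    have h3 : (ρ * n / 2 * (j / k n)) * Real.log (1 + k n * P) ≤
        (ρ * n / 2 * (j / k n)) * (Real.log (1 + k n * q) + ε / 2) :=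
      mul_le_mul_of_nonneg_left hlogPq (by positivity)
    have e1 : ρ * (j * (n / (2 * k n) * (Real.log (1 + k n * P) - ε))) =
        (ρ * n / 2 * (j / k n)) * Real.log (1 + k n * P) - (ρ * n / 2 * (j / k n)) * ε := by
      field_simp
    rw [e1]
    unfold logExcess
    linarith

/-! ### Measurable maximum-likelihood decoding and selection of a code -/

lemma measurable_isMLDecision {l M n : ℕ} {α : Type*} [MeasurableSpace α]
    {s : α → Fin l → Fin (M + 1) → Fin n → ℝ} (hs : Measurable s) {y : α → Fin n → ℝ}
    (hy : Measurable y) (A : Finset (Fin l)) (w : Fin l → Fin (M + 1)) :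
    Measurable fun a => IsMLDecision (s a) A (y a) w := by
  have h : ∀ w' : Fin l → Fin (M + 1),
      Measurable fun a => ∑ t, (y a t - ∑ i, s a i (w' i) t) ^ 2 := by
    intro w'
    fun_prop
  unfold IsMLDecision
  refine measurable_const.and (Measurable.forall fun w' => Measurable.imp measurable_const ?_)
  exact measurableSet_setOfPred.1 (measurableSet_le (h w) (h w'))

lemma measurableSet_mlFailure {l M n : ℕ} (P : ℝ) (A : Finset (Fin l))
    (w : Fin l → Fin (M + 1)) :
    MeasurableSet {x : (Fin l → Fin (M + 1) → Fin n → ℝ) × (Fin n → ℝ) |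
      MLFailure P x.1 A w x.2} := by
  refine measurableSet_setOfPred.2 ?_
  unfold MLFailure
  refine Measurable.or (Measurable.exists fun w' => Measurable.and ?_ measurable_const)
    (Measurable.exists fun i => measurableSet_setOfPred.1 (measurableSet_lt measurable_const ?_))
  · refine measurable_isMLDecision measurable_fst ?_ A w'
    unfold received
    fun_prop
  · fun_prop

/-- The maximum likelihood decision if there is only one, and an arbitrary decision otherwise. -/
noncomputable def mlDecoder {l M n : ℕ} (s : Fin l → Fin (M + 1) → Fin n → ℝ) (A : Finset (Fin l))
    (y : Fin n → ℝ) : Fin l → Fin (M + 1) :=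
  open Classical in
  if h : ∃ w, ∀ w', IsMLDecision s A y w' ↔ w' = w then h.choose else 0

lemma mlDecoder_eq {l M n : ℕ} {s : Fin l → Fin (M + 1) → Fin n → ℝ} {A : Finset (Fin l)}
    {y : Fin n → ℝ} {w : Fin l → Fin (M + 1)} (h : ∀ w', IsMLDecision s A y w' ↔ w' = w) :
    mlDecoder s A y = w := by
  have hex : ∃ w, ∀ w', IsMLDecision s A y w' ↔ w' = w := ⟨w, h⟩
  rw [mlDecoder, dif_pos hex, ← h, hex.choose_spec]

lemma measurable_mlDecoder {l M n : ℕ} (s : Fin l → Fin (M + 1) → Fin n → ℝ)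
    (A : Finset (Fin l)) : Measurable (mlDecoder s A) := by
  have hu : ∀ w, Measurable fun y => ∀ w', IsMLDecision s A y w' ↔ w' = w := fun w =>
    Measurable.forall fun w' =>
      (measurable_isMLDecision measurable_const measurable_id A w').iff measurable_const
  refine measurable_to_countable' fun w => ?_
  have hpre : mlDecoder s A ⁻¹' {w} = {y | (∀ w', IsMLDecision s A y w' ↔ w' = w) ∨
      (¬ (∃ w, ∀ w', IsMLDecision s A y w' ↔ w' = w) ∧ 0 = w)} := by
    ext y
    rw [Set.mem_preimage, Set.mem_singleton_iff, Set.mem_ofPred_eq]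
    constructor
    · intro h
      by_cases hex : ∃ w, ∀ w', IsMLDecision s A y w' ↔ w' = w
      · obtain ⟨w₀, hw₀⟩ := hex
        rw [mlDecoder_eq hw₀] at h
        exact Or.inl (h ▸ hw₀)
      · rw [mlDecoder, dif_neg hex] at h
        exact Or.inr ⟨hex, h⟩
    · rintro (h | ⟨hex, h⟩)
      · exact mlDecoder_eq h
      · rw [mlDecoder, dif_neg hex, h]
  rw [hpre]
  exact measurableSet_setOfPred.2 ((hu w).or ((Measurable.exists hu).not.and measurable_const))

lemma exists_isMLDecision {l M n : ℕ} (s : Fin l → Fin (M + 1) → Fin n → ℝ) {A : Finset (Fin l)}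
    (y : Fin n → ℝ) (h : (messages M A).Nonempty) : ∃ w, IsMLDecision s A y w := by
  obtain ⟨w, hw, hmin⟩ := (messages M A).exists_min_image
    (fun w => ∑ t, (y t - ∑ i, s i (w i) t) ^ 2) h
  exact ⟨w, hw, hmin⟩

/-- The code that uses the codebooks `s`, except that codewords that violate the power constraint
are replaced by zero, with maximum likelihood decoding for `s`. -/
noncomputable def clippedCode {l M n : ℕ} {P : ℝ} (hP : 0 < P)
    (s : Fin l → Fin (M + 1) → Fin n → ℝ) (hs : ∀ i, s i 0 = 0) : Code l M n P where
  enc i w := open Classical in if (1 / (n : ℝ)) * ∑ t, s i w t ^ 2 ≤ P then s i w else 0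
  power i w := by
    split_ifs with h
    · exact h
    · simpa using hP.le
  enc_zero i := by simp [hs]
  dec := mlDecoder s
  measurable_dec := measurable_mlDecoder s

/-- Off the failure event no transmitted codeword is clipped, so the received word is the one for
`s`. No maximum-likelihood decision differs from `w`, and since one exists, it is `w` and the
decoder finds it. -/
lemma clippedCode_errorGiven_le {l M n : ℕ} {P : ℝ} (hP : 0 < P)
    (s : Fin l → Fin (M + 1) → Fin n → ℝ) (hs : ∀ i, s i 0 = 0) {A : Finset (Fin l)}
    {w : Fin l → Fin (M + 1)} (hw : w ∈ messages M A) :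
    (clippedCode hP s hs).errorGiven A w ≤ (noise n).real {z | MLFailure P s A w z} := by
  refine measureReal_mono fun z hz => ?_
  by_contra hfail
  rw [Set.mem_ofPred_eq, MLFailure, not_or] at hfail
  obtain ⟨h1, h2⟩ := hfail
  push Not at h1 h2
  have henc : ∀ i, (clippedCode hP s hs).enc i (w i) = s i (w i) := fun i => if_pos (h2 i)
  have hrec : received (clippedCode hP s hs).enc w z = received s w z := by
    simp only [received, henc]
  refine hz ?_
  rw [hrec]
  refine mlDecoder_eq fun w' => ⟨h1 w', ?_⟩
  rintro rfl
  obtain ⟨w₀, hw₀⟩ := exists_isMLDecision s (received s w' z) ⟨w', hw⟩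
  have heq := h1 w₀ hw₀
  rw [heq] at hw₀
  exact hw₀

/-- Some code is at least as good as the Gaussian random codebooks are on average. -/
lemma exists_code_avgError_le {l M n : ℕ} {P : ℝ} (hP : 0 < P) (Q : ℝ≥0)
    (π : PMF (Finset (Fin l))) :
    ∃ c : Code l M n P, c.avgError π ≤ gaussianMLError l M n P Q π := by
  let f : (Fin l → Fin (M + 1) → Fin n → ℝ) → ℝ := fun s => ∑ A, (π A).toReal *
    ((∑ w ∈ messages M A, (noise n).real {z | MLFailure P s A w z}) / (M : ℝ) ^ A.card)
  have hint : ∀ A w, Integrable (fun s : Fin l → Fin (M + 1) → Fin n → ℝ =>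
      (noise n).real {z | MLFailure P s A w z}) (gaussianCodebooks l M n Q) := by
    intro A w
    refine Integrable.of_bound (C := 1)
      (measurable_measure_prodMk_left
        (measurableSet_mlFailure P A w)).ennreal_toReal.aestronglyMeasurable
      (Eventually.of_forall fun s => ?_)
    rw [Real.norm_of_nonneg measureReal_nonneg]
    exact measureReal_le_one
  have hval : ∀ A w, ∫ s, (noise n).real {z | MLFailure P s A w z} ∂gaussianCodebooks l M n Q =
      ((gaussianCodebooks l M n Q).prod (noise n)).real {x | MLFailure P x.1 A w x.2} := by
    intro A w
    have hm := measurableSet_mlFailure (n := n) P A w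
    rw [measureReal_def, Measure.prod_apply hm]
    exact integral_toReal (measurable_measure_prodMk_left hm).aemeasurable
      (Eventually.of_forall fun s => measure_lt_top _ _)
  have hf : Integrable f (gaussianCodebooks l M n Q) :=
    integrable_finsetSum _ fun A _ =>
      ((integrable_finsetSum _ fun w _ => hint A w).div_const _).const_mul _
  have hfval : ∫ s, f s ∂gaussianCodebooks l M n Q = gaussianMLError l M n P Q π := by
    unfold gaussianMLError
    rw [integral_finsetSum _ fun A _ =>
      ((integrable_finsetSum _ fun w _ => hint A w).div_const _).const_mul _]
    refine Finset.sum_congr rfl fun A _ => ?_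
    rw [integral_const_mul, integral_div, integral_finsetSum _ fun w _ => hint A w]
    simp_rw [hval]
  -- Some codebook is no worse than the average and also avoids the null set on which message `0`
  -- has a nonzero codeword.
  obtain ⟨s, hs0, hs⟩ := exists_notMem_null_le_integral hf (ae_iff.1 (ae_codeword_zero Q))
  rw [Set.mem_ofPred_eq, not_not] at hs0
  refine ⟨clippedCode hP s hs0, ?_⟩
  rw [hfval] at hs
  refine le_trans (Finset.sum_le_sum fun A _ => ?_) hs
  refine mul_le_mul_of_nonneg_left ?_ ENNReal.toReal_nonneg
  gcongr with w hw
  exact clippedCode_errorGiven_le hP s hs0 hw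

/-! ### Achievability -/

lemma Code.avgError_nonneg {l M n : ℕ} {P : ℝ} (c : Code l M n P) (π : PMF (Finset (Fin l))) :
    0 ≤ c.avgError π :=
  Finset.sum_nonneg fun A _ => mul_nonneg ENNReal.toReal_nonneg
    (div_nonneg (Finset.sum_nonneg fun w _ => measureReal_nonneg) (by positivity))

/-- One quarter of `ε` pays for each loss: `log (P / Q) = ε / 4`, and `log (1 + ρ) ≤ ρ ≤ ε / 4`. -/
lemma exists_power_and_exponent {P ε : ℝ} (hP : 0 < P) (hε : 0 < ε) :
    ∃ (Q : ℝ≥0) (ρ : ℝ), 0 < Q ∧ (Q : ℝ) < P ∧ 0 < ρ ∧ ρ ≤ 1 ∧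
      Real.log (P / Q) + Real.log (1 + ρ) ≤ ε / 2 := by
  have hQ : 0 < P * Real.exp (-(ε / 4)) := by positivity
  refine ⟨⟨P * Real.exp (-(ε / 4)), hQ.le⟩, min 1 (ε / 4), hQ, ?_, by positivity, min_le_left _ _, ?_⟩
  · change P * Real.exp (-(ε / 4)) < P
    exact mul_lt_of_lt_one_right hP (Real.exp_lt_one_iff.2 (by linarith))
  · change Real.log (P / (P * Real.exp (-(ε / 4)))) + _ ≤ _
    have h1 : P / (P * Real.exp (-(ε / 4))) = Real.exp (ε / 4) := by
      rw [Real.exp_neg]; field_simp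
    have h2 := Real.log_le_sub_one_of_pos (show 0 < 1 + min 1 (ε / 4) by positivity)
    have h3 := min_le_right 1 (ε / 4)
    rw [h1, Real.log_exp]
    linarith

/-- Gaussian random codebooks whose number of messages exceeds `exp (C₁ (1 - ε / log (1 + k P)))`
by less than one have vanishing error probability. -/
lemma tendsto_gaussianMLError {P ε : ℝ} (hP : 0 < P) (hε : 0 < ε) {l k : ℕ → ℕ}
    (hk : ∀ n, 0 < k n) (hkO : (fun n => (k n : ℝ)) =O[atTop] (fun n => (n : ℝ)))
    (π : ∀ n, PMF (Finset (Fin (l n)))) (hπ : ∀ n, ∀ A ∈ (π n).support, A.card = k n) :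
    ∃ Q : ℝ≥0, 0 < Q ∧ (Q : ℝ) < P ∧ ∀ v : ℕ → ℝ,
      (∀ n, v n ≤ C₁ P (k n) n * (1 - ε / Real.log (1 + (k n : ℝ) * P))) →
      Tendsto (fun n => gaussianMLError (l n) ⌈Real.exp (v n)⌉₊ n P Q (π n)) atTop (𝓝 0) := by
  obtain ⟨Q, ρ, hQ, hQP, hρ, hρ1, hloss⟩ := exists_power_and_exponent hP hε
  refine ⟨Q, hQ, hQP, fun v hv => ?_⟩
  have hbound := tendsto_codingBound (M := fun n => ⌈Real.exp (v n)⌉₊) hP hε hQ hQP hρ hloss hk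
    hkO fun n => by
      refine le_trans ?_ (Real.exp_le_exp.2 (hv n))
      have h1 := Nat.ceil_lt_add_one (Real.exp_pos (v n)).le
      rw [Nat.cast_sub (Nat.one_le_ceil_iff.2 (Real.exp_pos _))]
      push_cast
      linarith
  refine squeeze_zero' (Eventually.of_forall fun n => ?_) ?_ hbound
  · exact Finset.sum_nonneg fun A _ => mul_nonneg ENNReal.toReal_nonneg
      (div_nonneg (Finset.sum_nonneg fun w _ => measureReal_nonneg) (by positivity))
  · filter_upwards [eventually_gt_atTop 0] with n hn
    exact gaussianMLError_le hQ hQP hn (Nat.ceil_pos.2 (Real.exp_pos _)) (π n) (hπ n) hρ hρ1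

lemma achievable_of_le {P ε : ℝ} (hP : 0 < P) (hε : 0 < ε) {l k : ℕ → ℕ}
    (hk : ∀ n, 0 < k n) (hkO : (fun n => (k n : ℝ)) =O[atTop] (fun n => (n : ℝ)))
    (π : ∀ n, PMF (Finset (Fin (l n)))) (hπ : ∀ n, ∀ A ∈ (π n).support, A.card = k n)
    {v : ℕ → ℝ} (hv : ∀ n, v n ≤ C₁ P (k n) n * (1 - ε / Real.log (1 + (k n : ℝ) * P))) :
    Achievable l π P v := by
  obtain ⟨Q, -, -, h⟩ := tendsto_gaussianMLError hP hε hk hkO π hπ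
  choose c hc using fun n => exists_code_avgError_le (M := ⌈Real.exp (v n)⌉₊) (n := n) hP Q (π n)
  exact ⟨c, squeeze_zero (fun n => (c n).avgError_nonneg _) hc (h v hv)⟩

/-- As `log (1 + k P) ≥ log (1 + P)` for `k ≥ 1`, a relative loss `ε` leaves room for the additive
loss `ε * log (1 + P)` in the logarithm. -/
lemma achievable_one_sub_mul {P ε : ℝ} (hP : 0 < P) (hε : 0 < ε) {l k : ℕ → ℕ}
    (hk : ∀ n, 0 < k n) (hkO : (fun n => (k n : ℝ)) =O[atTop] (fun n => (n : ℝ)))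
    (π : ∀ n, PMF (Finset (Fin (l n)))) (hπ : ∀ n, ∀ A ∈ (π n).support, A.card = k n) :
    Achievable l π P (fun n => (1 - ε) * C₁ P (k n) n) := by
  have hlog : 0 < Real.log (1 + P) := Real.log_pos (by linarith)
  refine achievable_of_le hP (mul_pos hε hlog) hk hkO π hπ fun n => ?_
  have hk1 : (1 : ℝ) ≤ k n := by exact_mod_cast hk n
  have h1 : Real.log (1 + P) ≤ Real.log (1 + k n * P) :=
    Real.log_le_log (by linarith) (by nlinarith)
  have h2 : ε * Real.log (1 + P) / Real.log (1 + k n * P) ≤ ε := by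
    rw [div_le_iff₀ (hlog.trans_le h1)]
    exact mul_le_mul_of_nonneg_left h1 hε.le
  have h3 : 0 ≤ C₁ P (k n) n := mul_nonneg (by positivity) (hlog.le.trans h1)
  rw [mul_comm]
  exact mul_le_mul_of_nonneg_left (by linarith) h3

/-! ### Variance of sums of independent uniform choices -/

section CenteredSums

variable {ι α : Type*} [Fintype ι] [DecidableEq ι] (S : ι → Finset α) (a : ι → α → ℝ)

/-- The sum over the box is a product of coordinate sums, of which the `i`-th vanishes. -/
lemma sum_piFinset_eq_zero {i : ι} (hi : ∑ u ∈ S i, a i u = 0) :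
    ∑ w ∈ Fintype.piFinset S, a i (w i) = 0 := by
  have h := Finset.prod_univ_sum S (fun p u => if p = i then a i u else (1 : ℝ))
  have h0 : ∏ p, ∑ u ∈ S p, (if p = i then a i u else (1 : ℝ)) = 0 :=
    Finset.prod_eq_zero (Finset.mem_univ i) (by simpa using hi)
  rw [h0] at h
  rw [h]
  refine Finset.sum_congr rfl fun w _ => ?_
  rw [Finset.prod_eq_single i] <;> simp +contextual

lemma sum_piFinset_mul_eq_zero {i j : ι} (hij : i ≠ j) (hi : ∑ u ∈ S i, a i u = 0) :
    ∑ w ∈ Fintype.piFinset S, a i (w i) * a j (w j) = 0 := by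
  have h := Finset.prod_univ_sum S
    (fun p u => (if p = i then a i u else (1 : ℝ)) * (if p = j then a j u else 1))
  have h0 : ∏ p, ∑ u ∈ S p, (if p = i then a i u else (1 : ℝ)) * (if p = j then a j u else 1) =
      0 := Finset.prod_eq_zero (Finset.mem_univ i) (by simpa [hij] using hi)
  rw [h0] at h
  rw [h]
  refine Finset.sum_congr rfl fun w _ => ?_
  rw [Finset.prod_mul_distrib]
  congr 1
  · rw [Finset.prod_eq_single i] <;> simp +contextual
  · rw [Finset.prod_eq_single j] <;> simp +contextual

/-- The variance of a sum of independent random variables, each of which is uniformly distributed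
over finitely many values, is at most the sum of the second moments. -/
lemma sum_piFinset_sq_sub_le (e : ι → α → ℝ) (μ : ι → ℝ)
    (hμ : ∀ i, ∑ u ∈ S i, (e i u - μ i) = 0) :
    ∑ w ∈ Fintype.piFinset S, (∑ i, e i (w i) - ∑ i, μ i) ^ 2 ≤
      ∑ w ∈ Fintype.piFinset S, ∑ i, e i (w i) ^ 2 := by
  have h1 : ∀ w : ι → α, (∑ i, e i (w i) - ∑ i, μ i) ^ 2 =
      ∑ i, ∑ j, (e i (w i) - μ i) * (e j (w j) - μ j) := by
    intro w
    rw [← Finset.sum_sub_distrib, sq, Finset.sum_mul_sum]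
  simp_rw [h1]
  rw [Finset.sum_comm, Finset.sum_comm (t := Finset.univ)]
  refine Finset.sum_le_sum fun i _ => ?_
  rw [Finset.sum_comm, Finset.sum_eq_single i]
  · have h2 := sum_piFinset_eq_zero S (fun i u => e i u - μ i) (hμ i)
    have h3 : ∑ w ∈ Fintype.piFinset S, e i (w i) ^ 2 =
        ∑ w ∈ Fintype.piFinset S, (e i (w i) - μ i) * (e i (w i) - μ i) +
        2 * μ i * ∑ w ∈ Fintype.piFinset S, (e i (w i) - μ i) +
        ∑ _w ∈ Fintype.piFinset S, μ i ^ 2 := by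
      rw [Finset.mul_sum, ← Finset.sum_add_distrib, ← Finset.sum_add_distrib]
      exact Finset.sum_congr rfl fun w _ => by ring
    rw [h3, h2, mul_zero, add_zero]
    exact le_add_of_nonneg_right (Finset.sum_nonneg fun _ _ => sq_nonneg _)
  · intro j _ hj
    exact sum_piFinset_mul_eq_zero S (fun i u => e i u - μ i) hj.symm (hμ i)
  · simp

end CenteredSums

/-! ### Change of measure between Gaussian laws -/

lemma pi_withDensity_of_isProbabilityMeasure {ι : Type*} [Fintype ι] {α : ι → Type*}
    [∀ i, MeasurableSpace (α i)] (μ : ∀ i, Measure (α i)) [∀ i, IsProbabilityMeasure (μ i)]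
    (f : ∀ i, α i → ENNReal) (hf : ∀ i, Measurable (f i))
    [∀ i, IsProbabilityMeasure ((μ i).withDensity (f i))] :
    Measure.pi (fun i => (μ i).withDensity (f i)) =
      (Measure.pi μ).withDensity fun x => ∏ i, f i (x i) := by
  refine Measure.pi_eq fun s hs => ?_
  rw [withDensity_apply _ (MeasurableSet.univ_pi hs), ← lintegral_indicator
    (MeasurableSet.univ_pi hs)]
  have h1 : ∀ x : ∀ i, α i, (Set.univ.pi s).indicator (fun x => ∏ i, f i (x i)) x =
      ∏ i, (s i).indicator (f i) (x i) := by
    intro x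
    by_cases hx : x ∈ Set.univ.pi s
    · rw [Set.indicator_of_mem hx]
      exact Finset.prod_congr rfl fun i _ => (Set.indicator_of_mem (hx i trivial) _).symm
    · rw [Set.indicator_of_notMem hx]
      simp only [Set.mem_univ_pi, not_forall] at hx
      obtain ⟨i, hi⟩ := hx
      exact (Finset.prod_eq_zero (Finset.mem_univ i) (Set.indicator_of_notMem hi _)).symm
  simp_rw [h1]
  rw [lintegral_pi_prod μ (fun i => (s i).indicator (f i)) fun i => (hf i).indicator (hs i)]
  exact Finset.prod_congr rfl fun i _ => by
    rw [lintegral_indicator (hs i), withDensity_apply _ (hs i)]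

lemma gaussianReal_eq_withDensity (a : ℝ) {κ : ℝ≥0} (hκ : 0 < κ) :
    (gaussianReal 0 1).withDensity (fun z => ENNReal.ofReal
      (Real.exp (-(Real.log κ / 2 - z ^ 2 / 2 + (z - a) ^ 2 / (2 * κ))))) = gaussianReal a κ := by
  have hκ0 : (0 : ℝ) < κ := hκ
  rw [gaussianReal_of_var_ne_zero _ one_ne_zero, gaussianReal_of_var_ne_zero _ hκ.ne',
    ← withDensity_mul _ (measurable_gaussianPDF _ _) (by fun_prop)]
  congr 1
  ext z
  rw [Pi.mul_apply, gaussianPDF, gaussianPDF, ← ENNReal.ofReal_mul (gaussianPDFReal_nonneg _ _ _)]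
  congr 1
  rw [gaussianPDFReal, gaussianPDFReal]
  have h1 : (√(2 * Real.pi * κ))⁻¹ = (√(2 * Real.pi))⁻¹ * Real.exp (-(Real.log κ / 2)) := by
    rw [Real.sqrt_mul (by positivity), mul_inv, Real.exp_neg, Real.exp_half, Real.exp_log hκ0]
  rw [h1, NNReal.coe_one, mul_one, mul_assoc, ← Real.exp_add, mul_assoc, ← Real.exp_add]
  congr 2
  ring

/-- The information density between the noise and its translate: `-log` of the density of
independent Gaussian entries of means `a t` and variance `κ` with respect to the noise. -/
noncomputable def infoDensity {n : ℕ} (κ : ℝ≥0) (a z : Fin n → ℝ) : ℝ :=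
  n / 2 * Real.log κ - (∑ t, z t ^ 2) / 2 + (∑ t, (z t - a t) ^ 2) / (2 * κ)

lemma noise_withDensity {n : ℕ} {κ : ℝ≥0} (hκ : 0 < κ) (a : Fin n → ℝ) :
    (noise n).withDensity (fun z => ENNReal.ofReal (Real.exp (-infoDensity κ a z))) =
      Measure.pi fun t => gaussianReal (a t) κ := by
  have h1 := fun t => gaussianReal_eq_withDensity (a t) hκ
  have h2 : ∀ t, IsProbabilityMeasure ((gaussianReal 0 1).withDensity (fun z => ENNReal.ofReal
      (Real.exp (-(Real.log κ / 2 - z ^ 2 / 2 + (z - a t) ^ 2 / (2 * κ)))))) := fun t => by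
    rw [h1]; infer_instance
  have h3 := pi_withDensity_of_isProbabilityMeasure (fun _ : Fin n => gaussianReal 0 1)
    (fun t z => ENNReal.ofReal
      (Real.exp (-(Real.log κ / 2 - z ^ 2 / 2 + (z - a t) ^ 2 / (2 * κ))))) (by fun_prop)
  simp_rw [h1] at h3
  rw [h3, noise]
  congr 1
  ext z
  rw [← ENNReal.ofReal_prod_of_nonneg fun _ _ => (Real.exp_pos _).le, ← Real.exp_sum]
  congr 2
  rw [Finset.sum_neg_distrib, Finset.sum_add_distrib, Finset.sum_sub_distrib, ← Finset.sum_div,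
    ← Finset.sum_div, ← Finset.sum_div, infoDensity, Finset.sum_const, Finset.card_univ,
    Fintype.card_fin, nsmul_eq_mul]
  ring

lemma integrable_sq_sub_gaussianReal (a : ℝ) :
    Integrable (fun x => (x - a) ^ 2) (gaussianReal 0 1) :=
  ((memLp_id_gaussianReal 2).sub (memLp_const a)).integrable_sq

lemma integral_sq_sub_gaussianReal (a : ℝ) :
    ∫ x, (x - a) ^ 2 ∂gaussianReal 0 1 = 1 + a ^ 2 := by
  have h1 : Var[fun x => x; gaussianReal 0 1] = 1 := by
    rw [variance_fun_id_gaussianReal]; rfl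
  have h2 : ∫ x, x ^ 2 ∂gaussianReal 0 1 = 1 := by
    rw [variance_of_integral_eq_zero measurable_id'.aemeasurable integral_id_gaussianReal] at h1
    exact h1
  have i1 : Integrable (fun x : ℝ => x) (gaussianReal 0 1) :=
    (memLp_id_gaussianReal 1).integrable (le_of_eq rfl)
  have i2 : Integrable (fun x : ℝ => x ^ 2) (gaussianReal 0 1) := by
    simpa using integrable_sq_sub_gaussianReal 0
  have e : ∀ x : ℝ, (x - a) ^ 2 = x ^ 2 - 2 * a * x + a ^ 2 := fun x => by ring
  simp_rw [e]
  have i3 : Integrable (fun x : ℝ => 2 * a * x) (gaussianReal 0 1) := i1.const_mul _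
  have i4 : Integrable (fun x : ℝ => x ^ 2 - 2 * a * x) (gaussianReal 0 1) := i2.sub i3
  rw [integral_add i4 (integrable_const _), integral_sub i2 i3, integral_const_mul, integral_id_gaussianReal, h2]
  simp

lemma integrable_sum_sq_sub_noise {n : ℕ} (a : Fin n → ℝ) :
    Integrable (fun z => ∑ t, (z t - a t) ^ 2) (noise n) :=
  integrable_finsetSum _ fun t _ =>
    integrable_comp_eval (μ := fun _ : Fin n => gaussianReal 0 1) (i := t)
      (integrable_sq_sub_gaussianReal (a t))

lemma integral_sum_sq_sub_noise {n : ℕ} (a : Fin n → ℝ) :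
    ∫ z, ∑ t, (z t - a t) ^ 2 ∂noise n = n + ∑ t, a t ^ 2 := by
  have hi : ∀ t, Integrable (fun z : Fin n → ℝ => (z t - a t) ^ 2) (noise n) := fun t =>
    integrable_comp_eval (μ := fun _ : Fin n => gaussianReal 0 1) (i := t)
      (integrable_sq_sub_gaussianReal (a t))
  rw [integral_finsetSum _ fun t _ => hi t]
  have h : ∀ t, ∫ z, (z t - a t) ^ 2 ∂noise n = 1 + a t ^ 2 := fun t => by
    rw [← integral_sq_sub_gaussianReal]
    exact integral_comp_eval (μ := fun _ : Fin n => gaussianReal 0 1) (i := t)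
      (integrable_sq_sub_gaussianReal (a t)).aestronglyMeasurable
  simp_rw [h, Finset.sum_add_distrib]
  simp

lemma integrable_infoDensity {n : ℕ} (κ : ℝ≥0) (a : Fin n → ℝ) :
    Integrable (infoDensity κ a) (noise n) := by
  have h0 := integrable_sum_sq_sub_noise (0 : Fin n → ℝ)
  simp only [Pi.zero_apply, sub_zero] at h0
  exact ((integrable_const _).sub (h0.div_const 2)).add
    ((integrable_sum_sq_sub_noise a).div_const _)

/-- For `κ > 0` this is the relative entropy of the noise law with respect to the Gaussian law of
means `a t` and variance `κ`. -/
lemma integral_infoDensity {n : ℕ} (κ : ℝ≥0) (a : Fin n → ℝ) :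
    ∫ z, infoDensity κ a z ∂noise n =
      n / 2 * Real.log κ - n / 2 + (n + ∑ t, a t ^ 2) / (2 * κ) := by
  have h0 := integrable_sum_sq_sub_noise (0 : Fin n → ℝ)
  have h1 := integral_sum_sq_sub_noise (0 : Fin n → ℝ)
  simp only [Pi.zero_apply, sub_zero] at h0 h1
  unfold infoDensity
  have h2 : Integrable (fun z : Fin n → ℝ => n / 2 * Real.log κ - (∑ t, z t ^ 2) / 2) (noise n) :=
    (integrable_const _).sub (h0.div_const 2)
  rw [integral_add h2 ((integrable_sum_sq_sub_noise a).div_const _),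
    integral_sub (integrable_const _) (h0.div_const 2), integral_div, integral_div, integral_sum_sq_sub_noise, h1]
  simp

/-- A form of Fano's inequality: comparison of the probability of `D` under the noise with its
probability under a Gaussian law of means `a t` and variance `κ`. -/
lemma mul_noise_le {n : ℕ} {κ : ℝ≥0} (hκ : 0 < κ) (a : Fin n → ℝ) {D : Set (Fin n → ℝ)}
    (hD : MeasurableSet D) (r : ℝ) :
    r * (noise n).real D ≤ n / 2 * Real.log κ - n / 2 + (n + ∑ t, a t ^ 2) / (2 * κ) +
      (Real.exp r - 1) * (Measure.pi fun t => gaussianReal (a t) κ).real D := by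
  set R : (Fin n → ℝ) → ℝ := fun z => Real.exp (-infoDensity κ a z) with hR
  have hRm : Measurable R := by unfold R infoDensity; fun_prop
  have hset : ∀ E : Set (Fin n → ℝ), MeasurableSet E → ∫⁻ z in E, ENNReal.ofReal (R z) ∂noise n =
      (Measure.pi fun t => gaussianReal (a t) κ) E := by
    intro E hE
    rw [← noise_withDensity hκ a, withDensity_apply _ hE]
  have hRint : Integrable R (noise n) := by
    refine ⟨hRm.aestronglyMeasurable, ?_⟩
    rw [hasFiniteIntegral_iff_ofReal (Eventually.of_forall fun z => (Real.exp_pos _).le),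
      ← setLIntegral_univ, hset _ MeasurableSet.univ]
    exact measure_lt_top _ _
  have hRset : ∀ E : Set (Fin n → ℝ), MeasurableSet E → ∫ z in E, R z ∂noise n =
      (Measure.pi fun t => gaussianReal (a t) κ).real E := by
    intro E hE
    rw [integral_eq_lintegral_of_nonneg_ae (Eventually.of_forall fun z => (Real.exp_pos _).le)
      hRm.aestronglyMeasurable, hset E hE, measureReal_def]
  -- Both cases are `1 + x ≤ exp x`, with `x = r - infoDensity` on `D` and `x = -infoDensity` off
  -- it.
  have hpt : ∀ z, D.indicator (fun _ => r) z ≤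
      infoDensity κ a z - 1 + R z + (Real.exp r - 1) * D.indicator R z := by
    intro z
    by_cases hz : z ∈ D
    · rw [Set.indicator_of_mem hz, Set.indicator_of_mem hz]
      have h := Real.add_one_le_exp (-infoDensity κ a z + r)
      rw [Real.exp_add] at h
      simp only [hR]
      linarith
    · rw [Set.indicator_of_notMem hz, Set.indicator_of_notMem hz]
      have h := Real.add_one_le_exp (-infoDensity κ a z)
      simp only [hR]
      linarith
  have hi1 : Integrable (fun z => infoDensity κ a z - 1) (noise n) :=
    (integrable_infoDensity κ a).sub (integrable_const (1 : ℝ))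
  have hi3 : Integrable (fun z => infoDensity κ a z - 1 + R z) (noise n) := hi1.add hRint
  have hi2 := (hRint.indicator hD).const_mul (Real.exp r - 1)
  have h := integral_mono ((integrable_const r).indicator hD) (hi3.add hi2) hpt
  rw [integral_indicator hD, setIntegral_const, smul_eq_mul, mul_comm] at h
  refine h.trans (le_of_eq ?_)
  have e1 : ∫ z, R z ∂noise n = 1 := by
    rw [← setIntegral_univ, hRset _ MeasurableSet.univ, probReal_univ]
  have e2 : ∫ z, D.indicator R z ∂noise n =
      (Measure.pi fun t => gaussianReal (a t) κ).real D := by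
    rw [integral_indicator hD, hRset D hD]
  have e3 := integral_infoDensity κ a
  calc _ = ∫ z, infoDensity κ a z - 1 ∂noise n + ∫ z, R z ∂noise n +
        ∫ z, (Real.exp r - 1) * D.indicator R z ∂noise n := by
        rw [← integral_add hi1 hRint, ← integral_add hi3 hi2]; rfl
    _ = _ := by
        rw [integral_sub (integrable_infoDensity κ a) (integrable_const _), e3, e1,
          integral_const_mul, e2]
        simp

/-! ### The converse -/

lemma Code.sum_sq_le {l M n : ℕ} {P : ℝ} (c : Code l M n P) (i : Fin l) (u : Fin (M + 1)) :
    ∑ t, c.enc i u t ^ 2 ≤ n * P := by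
  have h := c.power i u
  rcases Nat.eq_zero_or_pos n with rfl | hn
  · simp
  · have hn0 : (0 : ℝ) < n := by exact_mod_cast hn
    rwa [one_div, inv_mul_le_iff₀ hn0] at h

/-- The centre is the mean superposition under uniform messages. Codewords may add up coherently, to
an energy of order `k ^ 2 * n * P`, but about the mean the cross terms cancel and variances add. -/
lemma Code.exists_center {l M n : ℕ} {P : ℝ} (c : Code l M n P) (hM : 0 < M)
    (A : Finset (Fin l)) : ∃ m : Fin n → ℝ,
      ∑ w ∈ messages M A, ∑ t, (∑ i, c.enc i (w i) t - m t) ^ 2 ≤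
        (M : ℝ) ^ A.card * (A.card * (n * P)) := by
  set S : Fin l → Finset (Fin (M + 1)) := fun i => if i ∈ A then Finset.univ.erase 0 else {0}
    with hS
  have hSne : ∀ i, ((S i).card : ℝ) ≠ 0 := by
    intro i
    simp only [hS]
    split_ifs
    · simp [hM.ne']
    · simp
  refine ⟨fun t => ∑ i, (∑ u ∈ S i, c.enc i u t) / (S i).card, ?_⟩
  calc _ = ∑ t, ∑ w ∈ Fintype.piFinset S,
          (∑ i, c.enc i (w i) t - ∑ i, (∑ u ∈ S i, c.enc i u t) / (S i).card) ^ 2 :=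
        Finset.sum_comm
    _ ≤ ∑ t, ∑ w ∈ Fintype.piFinset S, ∑ i, c.enc i (w i) t ^ 2 := by
        refine Finset.sum_le_sum fun t _ => sum_piFinset_sq_sub_le S (fun i u => c.enc i u t) _ ?_
        intro i
        rw [Finset.sum_sub_distrib, Finset.sum_const, nsmul_eq_mul, mul_div_cancel₀ _ (hSne i),
          sub_self]
    _ = ∑ w ∈ messages M A, ∑ i, ∑ t, c.enc i (w i) t ^ 2 := by
        rw [Finset.sum_comm]
        exact Finset.sum_congr rfl fun w _ => Finset.sum_comm
    _ ≤ ∑ _w ∈ messages M A, (A.card * (n * P)) := by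
        refine Finset.sum_le_sum fun w hw => ?_
        have h : ∀ i, ∑ t, c.enc i (w i) t ^ 2 ≤ if i ∈ A then n * P else 0 := by
          intro i
          split_ifs with hi
          · exact c.sum_sq_le i (w i)
          · rw [(mem_messages.1 hw).2 i hi, c.enc_zero]; simp
        refine (Finset.sum_le_sum fun i _ => h i).trans (le_of_eq ?_)
        rw [Finset.sum_ite_mem, Finset.univ_inter, Finset.sum_const, nsmul_eq_mul]
    _ = (M : ℝ) ^ A.card * (A.card * (n * P)) := by
        rw [Finset.sum_const, card_messages, nsmul_eq_mul, Nat.cast_pow]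

/-- The converse for a given set of `k` active users: `k log M` times the probability of a correct
decision is at most `n / 2 * log (1 + k P) + 1`. -/
lemma Code.sum_correct_le {l M n : ℕ} {P : ℝ} (hP : 0 < P) (c : Code l M n P) (hM : 0 < M)
    (A : Finset (Fin l)) :
    ∑ w ∈ messages M A, A.card * Real.log M * (1 - c.errorGiven A w) ≤
      (n / 2 * Real.log (1 + A.card * P) + 1) * (M : ℝ) ^ A.card := by
  obtain ⟨m, hm⟩ := c.exists_center hM A
  have hM0 : (0 : ℝ) < M := by exact_mod_cast hM
  have hκ0 : 0 < 1 + A.card * P := by positivity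
  -- The comparison law `N(m, κ)` is the same for all `w`. With this variance `-n/2 + (n + k n P) /
  -- (2κ)` vanishes, and the average divergence is at most `n/2 * log κ`.
  set κ : ℝ≥0 := ⟨1 + A.card * P, hκ0.le⟩ with hκdef
  have hκ : 0 < κ := hκ0
  have hκv : (κ : ℝ) = 1 + A.card * P := rfl
  set μ : Measure (Fin n → ℝ) := Measure.pi fun t => gaussianReal (m t) κ with hμ
  set D : (Fin l → Fin (M + 1)) → Set (Fin n → ℝ) := fun w => {y | c.dec A y = w} with hD
  have hDm : ∀ w, MeasurableSet (D w) := fun w =>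
    c.measurable_dec A (measurableSet_singleton w)
  have hexp : Real.exp (A.card * Real.log M) = (M : ℝ) ^ A.card := by
    rw [Real.exp_nat_mul, Real.exp_log hM0]
  have hrec : ∀ w, Measurable (received c.enc w) := fun w => by unfold received; fun_prop
  have hstep : ∀ w ∈ messages M A, A.card * Real.log M * (1 - c.errorGiven A w) ≤
      n / 2 * Real.log κ - n / 2 + (n + ∑ t, (∑ i, c.enc i (w i) t - m t) ^ 2) / (2 * κ) +
        ((M : ℝ) ^ A.card - 1) * μ.real (D w) := by
    intro w _
    have hpre : MeasurableSet (received c.enc w ⁻¹' D w) := hrec w (hDm w)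
    have h1 : 1 - c.errorGiven A w = (noise n).real (received c.enc w ⁻¹' D w) := by
      have : {z | c.dec A (received c.enc w z) ≠ w} = (received c.enc w ⁻¹' D w)ᶜ := rfl
      rw [errorGiven, this, probReal_compl_eq_one_sub hpre]
      ring
    -- Translation by the transmitted superposition carries means `a` to means `m`.
    set a : Fin n → ℝ := fun t => m t - ∑ i, c.enc i (w i) t with ha
    have h2 : (Measure.pi fun t => gaussianReal (a t) κ).real (received c.enc w ⁻¹' D w) =
        μ.real (D w) := by
      have e : (Measure.pi fun t => gaussianReal (a t) κ).map (received c.enc w) = μ := by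
        have e1 : received c.enc w = fun z t => (∑ i, c.enc i (w i) t) + z t := by
          ext z t; simp [received]
        rw [e1, Measure.pi_map_pi (fun t => by fun_prop)]
        simp_rw [gaussianReal_map_const_add]
        simp [ha, hμ]
      rw [← e, map_measureReal_apply (hrec w) (hDm w)]
    have h3 := mul_noise_le hκ a hpre (A.card * Real.log M)
    rw [hexp, h2] at h3
    rw [h1]
    refine h3.trans (le_of_eq ?_)
    have h4 : ∀ t, a t ^ 2 = (∑ i, c.enc i (w i) t - m t) ^ 2 := fun t => by
      simp only [ha]; ring
    simp_rw [h4]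
  refine (Finset.sum_le_sum hstep).trans ?_
  -- Disjoint decision regions have total mass at most one. With `exp r = M ^ k` the last term thus
  -- adds at most `M ^ k - 1` in all, whence the `+ 1` per message vector.
  have hdisj : ∑ w ∈ messages M A, μ.real (D w) ≤ 1 := by
    rw [← measureReal_biUnion_finset (fun w _ w' _ hne =>
      Set.disjoint_left.2 fun y hy hy' => hne (hy.symm.trans hy')) fun w _ => hDm w]
    exact measureReal_le_one
  have hM1 : (1 : ℝ) ≤ (M : ℝ) ^ A.card := one_le_pow₀ (by exact_mod_cast hM)
  have hsplit : ∑ w ∈ messages M A, (n / 2 * Real.log κ - n / 2 +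
        (n + ∑ t, (∑ i, c.enc i (w i) t - m t) ^ 2) / (2 * κ) +
        ((M : ℝ) ^ A.card - 1) * μ.real (D w)) =
      (M : ℝ) ^ A.card * (n / 2 * Real.log κ - n / 2 + n / (2 * κ)) +
        (∑ w ∈ messages M A, ∑ t, (∑ i, c.enc i (w i) t - m t) ^ 2) / (2 * κ) +
        ((M : ℝ) ^ A.card - 1) * ∑ w ∈ messages M A, μ.real (D w) := by
    rw [Finset.sum_add_distrib, Finset.mul_sum, Finset.sum_div]
    congr 1
    simp_rw [add_div, ← add_assoc]
    rw [Finset.sum_add_distrib, Finset.sum_const, card_messages, nsmul_eq_mul, Nat.cast_pow]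
  rw [hsplit]
  have h1 : (∑ w ∈ messages M A, ∑ t, (∑ i, c.enc i (w i) t - m t) ^ 2) / (2 * κ) ≤
      (M : ℝ) ^ A.card * (A.card * (n * P)) / (2 * κ) := by gcongr
  have h2 := mul_le_mul_of_nonneg_left hdisj (sub_nonneg.2 hM1)
  have h3 : (M : ℝ) ^ A.card * (n / 2 * Real.log κ - n / 2 + n / (2 * κ)) +
      (M : ℝ) ^ A.card * (A.card * (n * P)) / (2 * κ) =
      (M : ℝ) ^ A.card * (n / 2 * Real.log κ) := by
    have : (κ : ℝ) ≠ 0 := hκ0.ne'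
    have e : (n : ℝ) / (2 * κ) + A.card * (n * P) / (2 * κ) = n / 2 := by
      rw [← add_div, div_eq_div_iff (by positivity) two_ne_zero, hκv]; ring
    linear_combination (M : ℝ) ^ A.card * e
  rw [hκv] at *
  linarith

/-- Averaging the negated error probabilities turns the upper bound of `average_le` into the lower
bound wanted here. -/
lemma le_avgError {l M n k : ℕ} {P : ℝ} (hP : 0 < P) (c : Code l M n P) (hM : 1 < M)
    (hk : 0 < k) (π : PMF (Finset (Fin l))) (hπ : ∀ A ∈ π.support, A.card = k) :
    1 - (n / 2 * Real.log (1 + k * P) + 1) / (k * Real.log M) ≤ c.avgError π := by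
  have hk0 : (0 : ℝ) < k := by exact_mod_cast hk
  have hL : 0 < k * Real.log M := mul_pos hk0 (Real.log_pos (by exact_mod_cast hM))
  have h := average_le (by omega) π hπ (fun A w => -c.errorGiven A w)
    (-(1 - (n / 2 * Real.log (1 + k * P) + 1) / (k * Real.log M))) fun A hA => by
      have h1 := c.sum_correct_le hP (by omega : 0 < M) A
      rw [← Finset.mul_sum, Finset.sum_sub_distrib, Finset.sum_const, card_messages,
        nsmul_eq_mul, mul_one, hA, Nat.cast_pow] at h1
      rw [mul_comm, ← le_div_iff₀ hL] at h1
      rw [Finset.sum_neg_distrib]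
      have h2 : (n / 2 * Real.log (1 + k * P) + 1) * (M : ℝ) ^ k / (k * Real.log M) =
        (n / 2 * Real.log (1 + k * P) + 1) / (k * Real.log M) * (M : ℝ) ^ k := by ring
      rw [h2] at h1
      linarith
  have h2 : ∑ A, (π A).toReal * ((∑ w ∈ messages M A, -c.errorGiven A w) / (M : ℝ) ^ A.card) =
      -c.avgError π := by
    rw [Code.avgError, ← Finset.sum_neg_distrib]
    refine Finset.sum_congr rfl fun A _ => ?_
    rw [Finset.sum_neg_distrib]
    ring
  rw [h2] at h
  linarith

/-- With `I = n/2 * log (1 + k P)`, the error probability is at least `1 - (I + 1) / ((1 + ε) * I)`.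
Since `I ≥ n/2 * log (1 + P)` tends to infinity whatever `k` does, the `+ 1` is harmless: it is at
most `ε/2 * I` once `I ≥ 2 / ε`. -/
lemma not_achievable_one_add_mul {P ε : ℝ} (hP : 0 < P) (hε : 0 < ε) {l k : ℕ → ℕ}
    (hk : ∀ n, 0 < k n) (π : ∀ n, PMF (Finset (Fin (l n))))
    (hπ : ∀ n, ∀ A ∈ (π n).support, A.card = k n) :
    ¬ Achievable l π P (fun n => (1 + ε) * C₁ P (k n) n) := by
  rintro ⟨c, hc⟩
  have hlog : 0 < Real.log (1 + P) := Real.log_pos (by linarith)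
  have hI : Tendsto (fun n : ℕ => (n : ℝ) / 2 * Real.log (1 + P)) atTop atTop :=
    (tendsto_natCast_atTop_atTop.atTop_div_const two_pos).atTop_mul_const hlog
  have hδ : 0 < ε / 2 / (1 + ε) := by positivity
  obtain ⟨n, hn1, hn2⟩ := ((hc.eventually_lt_const hδ).and
    (hI.eventually_ge_atTop (2 / ε))).exists
  have hk0 : (0 : ℝ) < k n := by exact_mod_cast hk n
  have hk1 : (1 : ℝ) ≤ k n := by exact_mod_cast hk n
  set I : ℝ := n / 2 * Real.log (1 + k n * P) with hIdef
  have hI2 : 2 / ε ≤ I := by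
    refine hn2.trans (mul_le_mul_of_nonneg_left ?_ (by positivity))
    exact Real.log_le_log (by linarith) (by nlinarith)
  have hI0 : 0 < I := lt_of_lt_of_le (by positivity) hI2
  have hv : (1 + ε) * C₁ P (k n) n = (1 + ε) * I / k n := by
    rw [hIdef, C₁]; field_simp
  set M : ℕ := ⌈Real.exp ((1 + ε) * C₁ P (k n) n)⌉₊ with hMdef
  have hMge : Real.exp ((1 + ε) * I / k n) ≤ M := by
    rw [← hv]; exact Nat.le_ceil _
  have hvpos : 0 < (1 + ε) * I / k n := by positivity
  have hM : 1 < M := by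
    have : (1 : ℝ) < M := (Real.one_lt_exp_iff.2 hvpos).trans_le hMge
    exact_mod_cast this
  have hlogM : (1 + ε) * I ≤ k n * Real.log M := by
    have := (Real.le_log_iff_exp_le (by positivity)).2 hMge
    rwa [div_le_iff₀ hk0, mul_comm (Real.log M)] at this
  have h := le_avgError hP (c n) hM (hk n) (π n) (hπ n)
  have h2 : (I + 1) / (k n * Real.log M) ≤ (1 + ε / 2) / (1 + ε) := by
    calc (I + 1) / (k n * Real.log M) ≤ (I + 1) / ((1 + ε) * I) := by gcongr
      _ ≤ (1 + ε / 2) / (1 + ε) := by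
        rw [div_le_div_iff₀ (by positivity) (by positivity)]
        have : 2 ≤ I * ε := (div_le_iff₀ hε).1 hI2
        nlinarith
  have h3 : 1 - (1 + ε / 2) / (1 + ε) = ε / 2 / (1 + ε) := by field_simp; ring
  linarith

end ManyAccess

theorem theorem3 (P : ℝ) (hP : 0 < P)
    (l k : ℕ → ℕ) (hk : ∀ n, 0 < k n)
    (hkO : (fun n => (k n : ℝ)) =O[atTop] (fun n => (n : ℝ)))
    (π : ∀ n, PMF (Finset (Fin (l n))))
    (hπ : ∀ n, ∀ A ∈ (π n).support, A.card = k n) :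
    ManyAccess.IsSymmetricCapacity l π P (fun n => ManyAccess.C₁ P (k n) n) ∧
    (∀ ε : ℝ, 0 < ε →
      ManyAccess.Achievable l π P
        (fun n => ManyAccess.C₁ P (k n) n * (1 - ε / Real.log (1 + (k n : ℝ) * P)))) ∧
    (∀ ε : ℝ, 0 < ε → ∃ Q : ℝ≥0, 0 < Q ∧ (Q : ℝ) < P ∧
      Tendsto (fun n => ManyAccess.gaussianMLError (l n)
        ⌈Real.exp (ManyAccess.C₁ P (k n) n * (1 - ε / Real.log (1 + (k n : ℝ) * P)))⌉₊
        n P Q (π n)) atTop (𝓝 0)) := by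
  refine ⟨fun ε hε _ => ⟨ManyAccess.achievable_one_sub_mul hP hε hk hkO π hπ,
    ManyAccess.not_achievable_one_add_mul hP hε hk π hπ⟩, fun ε hε =>
    ManyAccess.achievable_of_le hP hε hk hkO π hπ fun _ => le_rfl, fun ε hε => ?_⟩
  obtain ⟨Q, hQ, hQP, h⟩ := ManyAccess.tendsto_gaussianMLError hP hε hk hkO π hπ
  exact ⟨Q, hQ, hQP, h _ fun _ => le_rfl⟩
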